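/- Let $X=\{(x_n,w_n)\}_{n=1}^N$ be a weighted point set with $N\ge 1$, $x_n\in\mathbb{R}^D$, $D\ge 1$, and weights $w_n\ge 0$; let $K\ge 1$ and let $m\ge 2$ be an integer. Memberships for $L$ clusters are numbers $R=\{r_{nl}\}_{n\le N,\,l\le L}\subset[0,1]$ with $\sum_{l} r_{nl}=1$ for every $n$. For means $C=(\mu_l)_{l\le L}$ in $\mathbb{R}^D$ and memberships $R$ put \[ \phi_X^{(m)}(C,R)=\sum_{n=1}^N\sum_{l=1}^L r_{nl}^m\, w_n\,\|x_n-\mu_l\|^2,\qquad R_l=\sum_{n=1}^N r_{nl}^m\, w_n . \] Write $\phi_X^{(m)}(R)$ for the cost of $R$ together with its induced means $\mu_l=R_l^{-1}\sum_n r_{nl}^m w_n x_n$, and $\phi_X^{(m)}(C)$ for the cost of $C$ together with its induced memberships $r_{nk}=\|x_n-\mu_k\|^{-2/(m-1)}/\sum_l\|x_n-\mu_l\|^{-2/(m-1)}$ (if $x_n$ coincides with some of the means, its membership is distributed among those means). The memberships $R$ are $(R_{\min},K)$-balanced if $L\le K$ and $R_l\ge R_{\min}$ for all $l\le L$; an optimal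 $(R_{\min},K)$-balanced solution has the smallest cost among all solutions with $(R_{\min},K)$-balanced memberships. Let $w_{\max}=\max_n w_n$. Algorithms are programs of a real random access machine with unit cost for the operations $+,-,\cdot,/$, comparison, powers $y^q$ and roots $y^{1/q}$ (for $q\in\mathbb{N}$) on reals, for addition, subtraction and comparison of natural numbers, and for access to memory; a randomized algorithm may also draw, at unit cost, independent uniform random numbers from $[0,1]$. (1) There are a randomized algorithm and an absolute constant $c$ such that, given $X\subset\mathbb{R}^D\times\mathbb{Q}_{\ge 0}$, $K$, $m$, $\epsilon\in(0,1]$ and $\alpha\in(0,1]$, the algorithm computes $K$ (not necessarily distinct) mean vectors $C$ in time at most \[ N\cdot D\cdot 2^{\,c\cdot\frac{K^2}{\epsilon}\cdot\max\{1,\ \log_2(1/(\alpha\epsilon))\}} , \] and, for every optimal $(R_{\min},K)$-balanced solution, with memberships $R^{opt}$, where \[ R_{\min}=\max\Bigl\{\alpha\sum_{n=1}^N w_n,\ \frac{16K w_{\max}}{\epsilon}\Bigr\}, \] we have $\phi_X^{(m)}(C)\le(1+\epsilon)\,\phi_X^{(m)}(R^{opt})$ with probability at least $1/2$. (2) There are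 a deterministic algorithm and an absolute constant $c$ such that, given $X\subset\mathbb{R}^D\times\mathbb{Q}_{\ge 0}$, $K$, $m$ and $\epsilon\in(0,1]$, the algorithm computes $K$ (not necessarily distinct) mean vectors $C$ in time at most $D\cdot\max\{N,2\}^{\,c\cdot K^2/\epsilon}$ such that $\phi_X^{(m)}(C)\le(1+\epsilon)\,\phi_X^{(m)}(R^{opt})$ for the memberships $R^{opt}$ of every optimal $(R_{\min},K)$-balanced solution with $R_{\min}=16K w_{\max}/\epsilon$. -/

import Mathlib

noncomputable section

namespace FuzzyKMeans

/-! ### The fuzzy `K`-means problem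

A weighted point set is a family of points `x : Fin N → EuclideanSpace ℝ (Fin D)` with
weights `w : Fin N → ℝ`.  Means are families `μ : Fin L → EuclideanSpace ℝ (Fin D)`. -/

/-- Membership values: every `r n l` is in `[0,1]`, and they sum to `1` at every point. -/
structure IsMembership {N L : ℕ} (r : Fin N → Fin L → ℝ) : Prop where
  nonneg : ∀ n l, 0 ≤ r n l
  le_one : ∀ n l, r n l ≤ 1
  sum_eq_one : ∀ n, ∑ l, r n l = 1

/-- The fuzzy cost of means `μ` and memberships `r`, with fuzzifier `m`. -/
def cost {N D L : ℕ} (m : ℕ) (x : Fin N → EuclideanSpace ℝ (Fin D)) (w : Fin N → ℝ)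
    (μ : Fin L → EuclideanSpace ℝ (Fin D)) (r : Fin N → Fin L → ℝ) : ℝ :=
  ∑ n, ∑ l, r n l ^ m * w n * ‖x n - μ l‖ ^ 2

/-- The weight `R_l` of the `l`-th fuzzy cluster. -/
def clusterWeight {N L : ℕ} (m : ℕ) (w : Fin N → ℝ) (r : Fin N → Fin L → ℝ) (l : Fin L) : ℝ :=
  ∑ n, r n l ^ m * w n

/-- The optimal means for given memberships (for a cluster of weight zero the mean does not
influence the cost; here it is then the origin). -/
def inducedMeans {N D L : ℕ} (m : ℕ) (x : Fin N → EuclideanSpace ℝ (Fin D)) (w : Fin N → ℝ)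
    (r : Fin N → Fin L → ℝ) (l : Fin L) : EuclideanSpace ℝ (Fin D) :=
  (clusterWeight m w r l)⁻¹ • ∑ n, (r n l ^ m * w n) • x n

open Classical in
/-- The optimal memberships for given means.  If `x n` coincides with some of the means, its
membership is distributed (evenly) among the means that are equal to `x n`. -/
def inducedMemberships {N D K : ℕ} (m : ℕ) (x : Fin N → EuclideanSpace ℝ (Fin D))
    (μ : Fin K → EuclideanSpace ℝ (Fin D)) (n : Fin N) (k : Fin K) : ℝ :=
  if ∃ l, x n = μ l then
    if x n = μ k then 1 / ((Finset.univ.filter fun l => x n = μ l).card : ℝ) else 0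
  else
    ‖x n - μ k‖ ^ (-(2 / ((m : ℝ) - 1))) / ∑ l, ‖x n - μ l‖ ^ (-(2 / ((m : ℝ) - 1)))

/-- The cost of the solution induced by means. -/
def costOfMeans {N D K : ℕ} (m : ℕ) (x : Fin N → EuclideanSpace ℝ (Fin D)) (w : Fin N → ℝ)
    (μ : Fin K → EuclideanSpace ℝ (Fin D)) : ℝ :=
  cost m x w μ (inducedMemberships m x μ)

/-- The cost of the solution induced by memberships. -/
def costOfMemberships {N D L : ℕ} (m : ℕ) (x : Fin N → EuclideanSpace ℝ (Fin D))
    (w : Fin N → ℝ) (r : Fin N → Fin L → ℝ) : ℝ :=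
  cost m x w (inducedMeans m x w r) r

/-- `(Rmin, K)`-balanced memberships: at most `K` clusters, each of weight at least `Rmin`. -/
structure IsBalanced {N L : ℕ} (m : ℕ) (w : Fin N → ℝ) (Rmin : ℝ) (K : ℕ)
    (r : Fin N → Fin L → ℝ) : Prop where
  isMembership : IsMembership r
  card_le : L ≤ K
  le_weight : ∀ l, Rmin ≤ clusterWeight m w r l

/-- The memberships `r` induce an optimal `(Rmin, K)`-balanced solution: `r` is balanced, and
the induced solution has the smallest cost among all solutions with balanced memberships. -/
def InducesOptimalBalanced {N D L : ℕ} (m : ℕ) (x : Fin N → EuclideanSpace ℝ (Fin D))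
    (w : Fin N → ℝ) (Rmin : ℝ) (K : ℕ) (r : Fin N → Fin L → ℝ) : Prop :=
  IsBalanced m w Rmin K r ∧
    ∀ (L' : ℕ) (μ' : Fin L' → EuclideanSpace ℝ (Fin D)) (r' : Fin N → Fin L' → ℝ),
      IsBalanced m w Rmin K r' → costOfMemberships m x w r ≤ cost m x w μ' r'

/-! ### Randomized real random access machines

Programs of a small imperative language.  The memory has natural-number cells (for counters
and indices) and real cells, both organised in arrays with two indices; array names are
natural numbers fixed in the program text, indices are computed at run time.  There is no
conversion from reals to natural numbers other than through comparisons.  Every elementary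
operation costs one time unit; on the reals these are `+`, `-`, `*`, `/`, comparison, powers
with natural exponent and roots of natural order, and drawing a number uniformly from
`[0,1]`. -/

/-- Memory, and the number of random numbers drawn so far. -/
structure State where
  nat : ℕ → ℕ → ℕ → ℕ
  real : ℕ → ℕ → ℕ → ℝ
  drawn : ℕ

/-- Overwrite one natural-number cell. -/
def State.writeNat (s : State) (a i j v : ℕ) : State :=
  { s with nat := fun a' i' j' => if a' = a ∧ i' = i ∧ j' = j then v else s.nat a' i' j' }

/-- Overwrite one real cell. -/
def State.writeReal (s : State) (a i j : ℕ) (v : ℝ) : State :=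
  { s with real := fun a' i' j' => if a' = a ∧ i' = i ∧ j' = j then v else s.real a' i' j' }

/-- Natural-number expressions: constants, cells `a[i][j]`, sum and truncated difference. -/
inductive NExpr : Type
  | const (n : ℕ)
  | cell (a : ℕ) (i j : NExpr)
  | add (e f : NExpr)
  | sub (e f : NExpr)

def NExpr.eval (s : State) : NExpr → ℕ
  | .const n => n
  | .cell a i j => s.nat a (i.eval s) (j.eval s)
  | .add e f => e.eval s + f.eval s
  | .sub e f => e.eval s - f.eval s

/-- Time for evaluating an expression: one unit for every node. -/
def NExpr.time : NExpr → ℕ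
  | .const _ => 1
  | .cell _ i j => i.time + j.time + 1
  | .add e f => e.time + f.time + 1
  | .sub e f => e.time + f.time + 1

/-- The `q`-th root of a nonnegative real number (`0` for negative numbers). -/
def root (y : ℝ) (q : ℕ) : ℝ := if 0 ≤ y then y ^ ((q : ℝ)⁻¹) else 0

/-- Real expressions; the constants of a program are rational. -/
inductive RExpr : Type
  | const (q : ℚ)
  | ofNat (e : NExpr)
  | cell (a : ℕ) (i j : NExpr)
  | add (e f : RExpr)
  | sub (e f : RExpr)
  | mul (e f : RExpr)
  | div (e f : RExpr)
  | pow (e : RExpr) (q : NExpr)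
  | root (e : RExpr) (q : NExpr)

/-- Value of a real expression (dividing by zero returns zero). -/
def RExpr.eval (s : State) : RExpr → ℝ
  | .const q => (q : ℝ)
  | .ofNat e => (e.eval s : ℝ)
  | .cell a i j => s.real a (i.eval s) (j.eval s)
  | .add e f => e.eval s + f.eval s
  | .sub e f => e.eval s - f.eval s
  | .mul e f => e.eval s * f.eval s
  | .div e f => e.eval s / f.eval s
  | .pow e q => e.eval s ^ q.eval s
  | .root e q => FuzzyKMeans.root (e.eval s) (q.eval s)

def RExpr.time : RExpr → ℕ
  | .const _ => 1
  | .ofNat e => e.time + 1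
  | .cell _ i j => i.time + j.time + 1
  | .add e f => e.time + f.time + 1
  | .sub e f => e.time + f.time + 1
  | .mul e f => e.time + f.time + 1
  | .div e f => e.time + f.time + 1
  | .pow e q => e.time + q.time + 1
  | .root e q => e.time + q.time + 1

/-- Tests: strict comparison of natural numbers or of reals, negation, conjunction. -/
inductive BExpr : Type
  | natLT (e f : NExpr)
  | realLT (e f : RExpr)
  | not (b : BExpr)
  | and (b c : BExpr)

def BExpr.Holds (s : State) : BExpr → Prop
  | .natLT e f => e.eval s < f.eval s
  | .realLT e f => e.eval s < f.eval s
  | .not b => ¬ b.Holds s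
  | .and b c => b.Holds s ∧ c.Holds s

def BExpr.time : BExpr → ℕ
  | .natLT e f => e.time + f.time + 1
  | .realLT e f => e.time + f.time + 1
  | .not b => b.time + 1
  | .and b c => b.time + c.time + 1

/-- Programs. -/
inductive Program : Type
  | skip
  | setNat (a : ℕ) (i j : NExpr) (e : NExpr)
  | setReal (a : ℕ) (i j : NExpr) (e : RExpr)
  | draw (a : ℕ) (i j : NExpr)
  | seq (p q : Program)
  | ite (b : BExpr) (p q : Program)
  | loop (b : BExpr) (p : Program)

/-- A program is deterministic if it does not draw random numbers. -/
def Program.Deterministic : Program → Prop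
  | .skip => True
  | .setNat _ _ _ _ => True
  | .setReal _ _ _ _ => True
  | .draw _ _ _ => False
  | .seq p q => p.Deterministic ∧ q.Deterministic
  | .ite _ p q => p.Deterministic ∧ q.Deterministic
  | .loop _ p => p.Deterministic

/-- `Exec ω p s s' t`: started in `s` with the random numbers `ω 0, ω 1, …`, the program `p`
halts in the state `s'` after exactly `t` time units.  (`loop b p` is "while `b` do `p`".) -/
inductive Exec (ω : ℕ → unitInterval) : Program → State → State → ℕ → Prop
  | skip (s : State) : Exec ω .skip s s 1
  | setNat (a : ℕ) (i j e : NExpr) (s : State) :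
      Exec ω (.setNat a i j e) s (s.writeNat a (i.eval s) (j.eval s) (e.eval s))
        (i.time + j.time + e.time + 1)
  | setReal (a : ℕ) (i j : NExpr) (e : RExpr) (s : State) :
      Exec ω (.setReal a i j e) s (s.writeReal a (i.eval s) (j.eval s) (e.eval s))
        (i.time + j.time + e.time + 1)
  | draw (a : ℕ) (i j : NExpr) (s : State) :
      Exec ω (.draw a i j) s
        { s.writeReal a (i.eval s) (j.eval s) (ω s.drawn : ℝ) with drawn := s.drawn + 1 }
        (i.time + j.time + 1)
  | seq {p q : Program} {s s' s'' : State} {t t' : ℕ} (hp : Exec ω p s s' t)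
      (hq : Exec ω q s' s'' t') : Exec ω (.seq p q) s s'' (t + t')
  | iteTrue {b : BExpr} {p q : Program} {s s' : State} {t : ℕ} (hb : b.Holds s)
      (hp : Exec ω p s s' t) : Exec ω (.ite b p q) s s' (b.time + t + 1)
  | iteFalse {b : BExpr} {p q : Program} {s s' : State} {t : ℕ} (hb : ¬ b.Holds s)
      (hq : Exec ω q s s' t) : Exec ω (.ite b p q) s s' (b.time + t + 1)
  | loopTrue {b : BExpr} {p : Program} {s s' s'' : State} {t t' : ℕ} (hb : b.Holds s)
      (hp : Exec ω p s s' t) (hl : Exec ω (.loop b p) s' s'' t') :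
      Exec ω (.loop b p) s s'' (b.time + t + t' + 1)
  | loopFalse {b : BExpr} {p : Program} {s : State} (hb : ¬ b.Holds s) :
      Exec ω (.loop b p) s s (b.time + 1)

/-- The law of the random numbers: independent and uniform on `[0,1]`. -/
def randomLaw : MeasureTheory.Measure (ℕ → unitInterval) :=
  MeasureTheory.Measure.infinitePi fun _ => MeasureTheory.volume

/-- The input.  Cell `[0][0]` of the natural-number arrays `0, 1, 2, 3` holds `N, D, K, m`; the
real array `0` holds the points, the real array `1` the weights (in column `0`), and cell
`[0][0]` of the real array `2` holds `ε`.  All other cells are zero. -/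
def inputState {N D : ℕ} (K m : ℕ) (x : Fin N → EuclideanSpace ℝ (Fin D)) (w : Fin N → ℝ)
    (ε : ℝ) : State where
  nat a i j :=
    if i = 0 ∧ j = 0 then
      if a = 0 then N else if a = 1 then D else if a = 2 then K else if a = 3 then m else 0
    else 0
  real a i j :=
    if a = 0 then if h : i < N ∧ j < D then x ⟨i, h.1⟩ ⟨j, h.2⟩ else 0
    else if a = 1 then if h : i < N ∧ j = 0 then w ⟨i, h.1⟩ else 0
    else if a = 2 ∧ i = 0 ∧ j = 0 then ε
    else 0
  drawn := 0

/-- The input with a further parameter `α`, held by cell `[0][0]` of the real array `3`. -/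
def inputStateWith {N D : ℕ} (K m : ℕ) (x : Fin N → EuclideanSpace ℝ (Fin D)) (w : Fin N → ℝ)
    (ε α : ℝ) : State :=
  (inputState K m x w ε).writeReal 3 0 0 α

/-- The output: `K` vectors, read from the real array `4`. -/
def outputMeans (D K : ℕ) (s : State) (k : Fin K) : EuclideanSpace ℝ (Fin D) :=
  WithLp.toLp 2 fun d => s.real 4 k d

/-- The program halts within time `T` on the given input and random numbers. -/
def HaltsWithin (ω : ℕ → unitInterval) (p : Program) (s : State) (T : ℝ) : Prop :=
  ∃ s' t, Exec ω p s s' t ∧ (t : ℝ) ≤ T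

end FuzzyKMeans

end

/-! Fix memberships with induced means `μ_l`, and let `a_n = r_{nl}^m w_n` be the mass of `x_n` in
cluster `l`, of total `R_l`. For every point `c`, `∑ a_n ‖x_n - c‖² = ∑ a_n ‖x_n - μ_l‖² + R_l ‖c -
μ_l‖²` (`sum_mul_norm_sub_sq`). So `c` can replace `μ_l` at relative loss `ε` as soon as `R_l ‖c -
μ_l‖² ≤ ε ∑ a_n ‖x_n - μ_l‖²`. The mean of `S` independent points drawn with probabilities `a_n /
R_l` makes the left side `1/S` times the sum on average. For `S = ⌈2/ε⌉`, Markov's inequality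
therefore makes a sample good with probability at least `1/2` (`half_le_sum_isGoodSample`). With one
good sample per cluster, the sample means and the old memberships cost at most `1 + ε` times the
original solution. Passing to the induced memberships does not raise the cost, by Jensen's
inequality (`le_sum_pow_mul`, `costOfMeans_le_cost`).

The deterministic algorithm tries all `N^(K S)` lists of sample indices and keeps the cheapest
means; some list is good for all clusters. The randomized algorithm cannot sample from the unknown
masses `a_n`, so it draws `x_n` with probability `w_n / W`, where `W` is the total weight. Since
`a_n ≤ w_n` and `R_l ≥ α W`, a sample is good for a given cluster with probability at least `α^S /
2`, and `K` independent samples are good for all clusters with probability at least `(α^S / 2)^K`.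
After `(2 / α^S)^K` trials the failure probability is at most `1/e` (`half_le_randomLaw_exists`).

Both algorithms are explicit programs sharing one search loop (`searchProg_spec`). They compare
candidates through the closed form `w_n / (∑_k ‖x_n - μ_k‖^(-2/(m-1)))^(m-1)` of the optimal cost of
a point. Since `K S = O(K²/ε)`, all polynomial factors of the running time are absorbed by the
exponentials. -/

noncomputable section

namespace FuzzyKMeans

/-! ### Total correctness with time bounds -/

/-- The natural-number arrays that a program may write. -/
def Program.natWrites : Program → List ℕ
  | .skip => []
  | .setNat a _ _ _ => [a]
  | .setReal _ _ _ _ => []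
  | .draw _ _ _ => []
  | .seq p q => p.natWrites ++ q.natWrites
  | .ite _ p q => p.natWrites ++ q.natWrites
  | .loop _ p => p.natWrites

/-- The real arrays that a program may write. -/
def Program.realWrites : Program → List ℕ
  | .skip => []
  | .setNat _ _ _ _ => []
  | .setReal a _ _ _ => [a]
  | .draw a _ _ => [a]
  | .seq p q => p.realWrites ++ q.realWrites
  | .ite _ p q => p.realWrites ++ q.realWrites
  | .loop _ p => p.realWrites

/-- The states `s` and `s'` agree on everything that `p` cannot write. -/
structure Frame (p : Program) (s s' : State) : Prop where
  nat : ∀ a, a ∉ p.natWrites → s'.nat a = s.nat a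
  real : ∀ a, a ∉ p.realWrites → s'.real a = s.real a
  drawn : p.Deterministic → s'.drawn = s.drawn

theorem Frame.rfl {p : Program} {s : State} : Frame p s s :=
  ⟨fun _ _ => Eq.refl _, fun _ _ => Eq.refl _, fun _ => Eq.refl _⟩

theorem Frame.trans {p : Program} {s s' s'' : State} (h : Frame p s s') (h' : Frame p s' s'') :
    Frame p s s'' :=
  ⟨fun a ha => (h'.nat a ha).trans (h.nat a ha), fun a ha => (h'.real a ha).trans (h.real a ha),
    fun hd => (h'.drawn hd).trans (h.drawn hd)⟩

/-- A frame of a program is a frame of each program with more effects. -/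
theorem Frame.mono {p q : Program} {s s' : State} (h : Frame p s s')
    (hn : p.natWrites ⊆ q.natWrites) (hr : p.realWrites ⊆ q.realWrites)
    (hd : q.Deterministic → p.Deterministic) : Frame q s s' :=
  ⟨fun a ha => h.nat a fun h' => ha (hn h'), fun a ha => h.real a fun h' => ha (hr h'),
    fun hq => h.drawn (hd hq)⟩

theorem Frame.seqLeft {p q : Program} {s s' : State} (h : Frame p s s') :
    Frame (.seq p q) s s' :=
  h.mono (List.subset_append_left _ _) (List.subset_append_left _ _) And.left

theorem Frame.seqRight {p q : Program} {s s' : State} (h : Frame q s s') :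
    Frame (.seq p q) s s' :=
  h.mono (List.subset_append_right _ _) (List.subset_append_right _ _) And.right

theorem Frame.iteLeft {b : BExpr} {p q : Program} {s s' : State} (h : Frame p s s') :
    Frame (.ite b p q) s s' :=
  h.mono (List.subset_append_left _ _) (List.subset_append_left _ _) And.left

theorem Frame.iteRight {b : BExpr} {p q : Program} {s s' : State} (h : Frame q s s') :
    Frame (.ite b p q) s s' :=
  h.mono (List.subset_append_right _ _) (List.subset_append_right _ _) And.right

theorem Frame.loop {b : BExpr} {p : Program} {s s' : State} (h : Frame p s s') :
    Frame (.loop b p) s s' :=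
  h.mono (fun _ h => h) (fun _ h => h) id

theorem State.writeNat_nat_of_ne {s : State} {a a' i j v : ℕ} (h : a' ≠ a) :
    (s.writeNat a i j v).nat a' = s.nat a' := by
  funext i' j'
  simp [State.writeNat, h]

theorem State.writeReal_real_of_ne {s : State} {a a' i j : ℕ} {v : ℝ} (h : a' ≠ a) :
    (s.writeReal a i j v).real a' = s.real a' := by
  funext i' j'
  simp [State.writeReal, h]

/-- The arrays a program may write are read off its text, so later uses close the side conditions by
`decide`. Loop invariants then need to mention only what actually changes. -/
theorem Exec.frame {ω : ℕ → unitInterval} {p : Program} {s s' : State} {t : ℕ}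
    (h : Exec ω p s s' t) : Frame p s s' := by
  induction h with
  | skip s => exact .rfl
  | setNat a i j e s =>
    refine ⟨fun a' ha => State.writeNat_nat_of_ne ?_, fun _ _ => rfl, fun _ => rfl⟩
    simpa [Program.natWrites] using ha
  | setReal a i j e s =>
    refine ⟨fun _ _ => rfl, fun a' ha => State.writeReal_real_of_ne ?_, fun _ => rfl⟩
    simpa [Program.realWrites] using ha
  | draw a i j s =>
    refine ⟨fun _ _ => rfl, fun a' ha => ?_, fun h => h.elim⟩
    exact State.writeReal_real_of_ne (by simpa [Program.realWrites] using ha)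
  | seq _ _ hp hq => exact hp.seqLeft.trans hq.seqRight
  | iteTrue _ _ hp => exact hp.iteLeft
  | iteFalse _ _ hq => exact hq.iteRight
  | loopTrue _ _ _ hp hl => exact hp.loop.trans hl
  | loopFalse _ => exact .rfl

/-- Started in `s`, the program `p` halts within `T` time units in a state satisfying `Q`. -/
def HaltsIn (ω : ℕ → unitInterval) (p : Program) (s : State) (T : ℕ) (Q : State → Prop) : Prop :=
  ∃ s' t, Exec ω p s s' t ∧ t ≤ T ∧ Q s'

namespace HaltsIn

variable {ω : ℕ → unitInterval} {p q : Program} {s : State} {T T' : ℕ} {Q Q' : State → Prop}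

theorem mono (h : HaltsIn ω p s T Q) (hT : T ≤ T') (hQ : ∀ s', Frame p s s' → Q s' → Q' s') :
    HaltsIn ω p s T' Q' := by
  obtain ⟨s', t, he, ht, hs⟩ := h
  exact ⟨s', t, he, ht.trans hT, hQ s' he.frame hs⟩

theorem mono_time (h : HaltsIn ω p s T Q) (hT : T ≤ T') : HaltsIn ω p s T' Q :=
  h.mono hT fun _ _ h => h

theorem skip (hQ : Q s) : HaltsIn ω .skip s 1 Q :=
  ⟨s, 1, .skip s, le_rfl, hQ⟩

theorem setNat {a : ℕ} {i j e : NExpr}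
    (hQ : Q (s.writeNat a (i.eval s) (j.eval s) (e.eval s))) :
    HaltsIn ω (.setNat a i j e) s (i.time + j.time + e.time + 1) Q :=
  ⟨_, _, .setNat a i j e s, le_rfl, hQ⟩

theorem setReal {a : ℕ} {i j : NExpr} {e : RExpr}
    (hQ : Q (s.writeReal a (i.eval s) (j.eval s) (e.eval s))) :
    HaltsIn ω (.setReal a i j e) s (i.time + j.time + e.time + 1) Q :=
  ⟨_, _, .setReal a i j e s, le_rfl, hQ⟩

theorem draw {a : ℕ} {i j : NExpr}
    (hQ : Q { s.writeReal a (i.eval s) (j.eval s) (ω s.drawn : ℝ) with drawn := s.drawn + 1 }) :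
    HaltsIn ω (.draw a i j) s (i.time + j.time + 1) Q :=
  ⟨_, _, .draw a i j s, le_rfl, hQ⟩

theorem seq (hp : HaltsIn ω p s T Q)
    (hq : ∀ s', Frame p s s' → Q s' → HaltsIn ω q s' T' Q') :
    HaltsIn ω (.seq p q) s (T + T') Q' := by
  obtain ⟨s', t, he, ht, hs⟩ := hp
  obtain ⟨s'', t', he', ht', hs'⟩ := hq s' he.frame hs
  exact ⟨s'', t + t', .seq he he', add_le_add ht ht', hs'⟩

theorem ite {b : BExpr} (hp : b.Holds s → HaltsIn ω p s T Q)
    (hq : ¬ b.Holds s → HaltsIn ω q s T Q) :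
    HaltsIn ω (.ite b p q) s (b.time + T + 1) Q := by
  by_cases hb : b.Holds s
  · obtain ⟨s', t, he, ht, hs⟩ := hp hb
    exact ⟨s', _, .iteTrue hb he, by omega, hs⟩
  · obtain ⟨s', t, he, ht, hs⟩ := hq hb
    exact ⟨s', _, .iteFalse hb he, by omega, hs⟩

/-- A loop that runs exactly `n` times. -/
theorem loop {b : BExpr} (J : ℕ → State → Prop) {n : ℕ} (h0 : J 0 s)
    (step : ∀ i < n, ∀ s', Frame (.loop b p) s s' → J i s' →
      b.Holds s' ∧ HaltsIn ω p s' T (J (i + 1)))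
    (hfinal : ∀ s', Frame (.loop b p) s s' → J n s' → ¬ b.Holds s') :
    HaltsIn ω (.loop b p) s (n * (T + b.time + 1) + b.time + 1) (J n) := by
  have key : ∀ k i, i + k = n → ∀ s', Frame (.loop b p) s s' → J i s' →
      HaltsIn ω (.loop b p) s' (k * (T + b.time + 1) + b.time + 1) (J n) := by
    intro k
    induction k with
    | zero =>
      intro i hi s' hf hJ
      obtain rfl : i = n := hi
      exact ⟨s', _, .loopFalse (hfinal s' hf hJ), by omega, hJ⟩
    | succ k ih =>
      intro i hi s' hf hJ
      obtain ⟨hb, s'', t, he, ht, hJ'⟩ := step i (by omega) s' hf hJ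
      obtain ⟨s₃, t', he', ht', hJ₃⟩ := ih (i + 1) (by omega) s'' (hf.trans he.frame.loop) hJ'
      refine ⟨s₃, _, .loopTrue hb he he', ?_, hJ₃⟩
      rw [Nat.succ_mul]
      omega
  exact key n 0 (zero_add n) s .rfl h0

end HaltsIn

attribute [simp] NExpr.eval RExpr.eval BExpr.Holds NExpr.time RExpr.time BExpr.time

/-- A natural-number variable: cell `[0][0]` of the array `a`. -/
abbrev NExpr.var (a : ℕ) : NExpr := .cell a (.const 0) (.const 0)

/-- A real variable: cell `[0][0]` of the array `a`. -/
abbrev RExpr.var (a : ℕ) : RExpr := .cell a (.const 0) (.const 0)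

/-- Assignment to a natural-number variable. -/
abbrev Program.assignNat (a : ℕ) (e : NExpr) : Program := .setNat a (.const 0) (.const 0) e

/-- Assignment to a real variable. -/
abbrev Program.assignReal (a : ℕ) (e : RExpr) : Program := .setReal a (.const 0) (.const 0) e

/-- `for v = 0, …, b - 1 do p`. -/
def Program.forLoop (v : ℕ) (b : NExpr) (p : Program) : Program :=
  .seq (.assignNat v (.const 0))
    (.loop (.natLT (.var v) b) (.seq p (.assignNat v (.add (.var v) (.const 1)))))

/-- The invariant must be insensitive to the counter, which is overwritten outside the body. The
frame handed to `step` transports facts about the initial state. The extra round in `n + 1` pays for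
the initialisation and the last test. -/
theorem HaltsIn.forLoop {ω : ℕ → unitInterval} {v : ℕ} {b : NExpr} {p : Program} {s : State}
    {n T : ℕ} (J : ℕ → State → Prop) (hv : v ∉ p.natWrites)
    (hb : ∀ s', Frame (.forLoop v b p) s s' → b.eval s' = n) (h0 : J 0 s)
    (hJ : ∀ i c s', J i s' → J i (s'.writeNat v 0 0 c))
    (step : ∀ i < n, ∀ s', Frame (.forLoop v b p) s s' → s'.nat v 0 0 = i → J i s' →
      HaltsIn ω p s' T (J (i + 1))) :
    HaltsIn ω (.forLoop v b p) s ((n + 1) * (T + b.time + 18)) (J n) := by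
  have h := HaltsIn.seq (ω := ω) (p := .assignNat v (.const 0))
    (q := .loop (.natLT (.var v) b) (.seq p (.assignNat v (.add (.var v) (.const 1)))))
    (s := s) (Q := fun s' => s'.nat v 0 0 = 0 ∧ J 0 s') (Q' := J n)
    (.setNat ⟨by simp [State.writeNat], hJ _ _ _ h0⟩)
    (T' := n * (T + (NExpr.var v |>.time) + b.time + 15) + b.time + 10) fun s₁ hf₁ hs₁ => ?_
  · refine h.mono_time ?_
    simp only [NExpr.time]
    nlinarith
  · have h := HaltsIn.loop (ω := ω) (b := .natLT (.var v) b)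
      (p := .seq p (.assignNat v (.add (.var v) (.const 1)))) (s := s₁) (n := n) (T := T + 8)
      (fun i s' => s'.nat v 0 0 = i ∧ J i s') hs₁ ?_ ?_
    · refine h.mono ?_ fun _ _ h => h.2
      simp only [NExpr.time, BExpr.time]
      nlinarith
    · intro i hi s' hf hs'
      have hF : Frame (.forLoop v b p) s s' := hf₁.seqLeft.trans hf.seqRight
      refine ⟨?_, ?_⟩
      · simp only [BExpr.Holds, NExpr.eval, hs'.1, hb s' hF, hi]
      · refine (HaltsIn.seq (step i hi s' hF hs'.1 hs'.2) fun s'' hf'' hs'' => .setNat ?_)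
        refine ⟨?_, hJ _ _ _ hs''⟩
        simp [State.writeNat, hf''.nat v hv, hs'.1]
    · intro s' hf hs'
      have hF : Frame (.forLoop v b p) s s' := hf₁.seqLeft.trans hf.seqRight
      simp [hs'.1, hb s' hF]

/-! ### Cost of a family of means, as computed by the programs -/

/-- The squared distance of the point `X n` and the mean `C k`. -/
def sqDist (D : ℕ) (X C : ℕ → ℕ → ℝ) (n k : ℕ) : ℝ :=
  ∑ d ∈ Finset.range D, (X n d - C k d) ^ 2

open Classical in
/-- The cost of the point `X n` of weight one with respect to the means `C`. -/
def pointCost (D K m : ℕ) (X C : ℕ → ℕ → ℝ) (n : ℕ) : ℝ :=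
  -- The coincident case is separated because division by zero returns zero, so the formula would
  -- silently drop the mean that serves the point for free.
  if ∀ k < K, 0 < sqDist D X C n k then
    1 / (∑ k ∈ Finset.range K, 1 / root (sqDist D X C n k) (m - 1)) ^ (m - 1)
  else 0

/-- The cost of the means `C`. -/
def totalCost (N D K m : ℕ) (X : ℕ → ℕ → ℝ) (w : ℕ → ℝ) (C : ℕ → ℕ → ℝ) : ℝ :=
  ∑ n ∈ Finset.range N, w n * pointCost D K m X C n

/-- The means of `K` groups of `S` sample points; `f` lists the indices of the samples. -/
def sampleMeans (S : ℕ) (X : ℕ → ℕ → ℝ) (f : ℕ → ℕ) (k d : ℕ) : ℝ :=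
  (∑ i ∈ Finset.range S, X (f (k * S + i)) d) / S

theorem totalCost_congr {N D K m : ℕ} {X : ℕ → ℕ → ℝ} {w : ℕ → ℝ} {C C' : ℕ → ℕ → ℝ}
    (h : ∀ k < K, ∀ d < D, C k d = C' k d) :
    totalCost N D K m X w C = totalCost N D K m X w C' := by
  have hd : ∀ n, ∀ k < K, sqDist D X C n k = sqDist D X C' n k := fun n k hk =>
    Finset.sum_congr rfl fun d hd => by rw [h k hk d (Finset.mem_range.1 hd)]
  refine Finset.sum_congr rfl fun n _ => ?_
  have h1 : (∀ k < K, 0 < sqDist D X C n k) ↔ ∀ k < K, 0 < sqDist D X C' n k :=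
    forall₂_congr fun k hk => by rw [hd n k hk]
  have h2 : ∑ k ∈ Finset.range K, 1 / root (sqDist D X C n k) (m - 1) =
      ∑ k ∈ Finset.range K, 1 / root (sqDist D X C' n k) (m - 1) :=
    Finset.sum_congr rfl fun k hk => by rw [hd n k (Finset.mem_range.1 hk)]
  rw [pointCost, pointCost, h2]
  simp only [h1]

theorem sampleMeans_congr {S K : ℕ} {X : ℕ → ℕ → ℝ} {f g : ℕ → ℕ}
    (h : ∀ j < K * S, f j = g j) {k : ℕ} (hk : k < K) (d : ℕ) :
    sampleMeans S X f k d = sampleMeans S X g k d := by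
  rw [sampleMeans, sampleMeans]
  refine congrArg (· / (S : ℝ)) (Finset.sum_congr rfl fun i hi => ?_)
  rw [h _ _]
  have := Finset.mem_range.1 hi
  calc k * S + i < k * S + S := by omega
    _ = (k + 1) * S := by ring
    _ ≤ K * S := Nat.mul_le_mul_right _ hk

/-! ### The programs

Arrays of natural numbers: `0, 1, 2, 3` input `N, D, K, m`; `4` the number `S` of samples for
each mean; `5` the number `K * S`; `6` the number of finished trials; `7` the indices of the
samples; `8` to `15` local variables.  Arrays of reals: `0, 1, 2, 3` input `X, w, ε, α`;
`4` the best means so far, `6` their cost; `5` the means of the current trial, `8` their cost;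
`7, 9, 10` local variables; `11` the total weight. -/

/-- Squared distance of point `n` (variable `13`) and current mean `k` (variable `10`). -/
def sqDistProg : Program :=
  .seq (.assignReal 7 (.const 0))
    (.forLoop 11 (.var 1)
      (.assignReal 7 (.add (.var 7)
        (.pow (.sub (.cell 0 (.var 13) (.var 11)) (.cell 5 (.var 10) (.var 11))) (.const 2)))))

/-- The sum of the inverse roots of the squared distances of point `n` and the means. -/
def pointProg : Program :=
  .seq (.assignReal 9 (.const 0))
    (.seq (.assignNat 14 (.const 0))
      (.forLoop 10 (.var 2)
        (.seq sqDistProg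
          (.seq (.assignReal 9 (.add (.var 9)
              (.div (.const 1) (.root (.var 7) (.sub (.var 3) (.const 1))))))
            (.ite (.realLT (.const 0) (.var 7)) .skip (.assignNat 14 (.const 1)))))))

/-- The cost of the current means. -/
def costProg : Program :=
  .seq (.assignReal 8 (.const 0))
    (.forLoop 13 (.var 0)
      (.seq pointProg
        (.ite (.natLT (.var 14) (.const 1))
          (.assignReal 8 (.add (.var 8) (.mul (.cell 1 (.var 13) (.const 0))
            (.div (.const 1) (.pow (.var 9) (.sub (.var 3) (.const 1)))))))
          .skip)))

/-- Coordinate `d` (variable `11`) of the current mean `k` (variable `10`); the samples start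
at the position given by variable `9`. -/
def coordProg : Program :=
  .seq (.assignReal 7 (.const 0))
    (.seq
      (.forLoop 12 (.var 4)
        (.assignReal 7 (.add (.var 7)
          (.cell 0 (.cell 7 (.add (.var 9) (.var 12)) (.const 0)) (.var 11)))))
      (.setReal 5 (.var 10) (.var 11) (.div (.var 7) (.ofNat (.var 4)))))

/-- The current mean `k` (variable `10`). -/
def meanProg : Program :=
  .forLoop 11 (.var 1) coordProg

/-- The means of the samples. -/
def meansProg : Program :=
  .seq (.assignNat 9 (.const 0))
    (.forLoop 10 (.var 2)
      (.seq meanProg (.assignNat 9 (.add (.var 9) (.var 4)))))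

/-- Copy the current means to the output. -/
def copyProg : Program :=
  .forLoop 10 (.var 2)
    (.forLoop 11 (.var 1)
      (.setReal 4 (.var 10) (.var 11) (.cell 5 (.var 10) (.var 11))))

/-- Keep the current means if they are better than the best ones so far. -/
def updateProg : Program :=
  .ite (.realLT (.var 8) (.var 6)) (.seq (.assignReal 6 (.var 8)) copyProg) .skip

/-- One trial, for given samples. -/
def trialProg : Program :=
  .seq meansProg (.seq costProg updateProg)

/-- Carry out trials, with samples generated by `gen`, until their number reaches `B`. -/
def searchProg (gen : Program) (B : RExpr) : Program :=
  -- The bound is a real number that need not be an integer; comparing the counter with it yields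
  -- `⌈B⌉₊` trials.
  .loop (.realLT (.ofNat (.var 6)) B)
    (.seq gen (.seq trialProg (.assignNat 6 (.add (.var 6) (.const 1)))))

/-- Compute the number `S` of samples for each mean, and `K * S`. -/
def sizeProg : Program :=
  -- The loop stops at the least `S` with `S * ε ≥ 2`. The product `K * S` is accumulated by
  -- additions, as the machine does not multiply natural numbers.
  .loop (.realLT (.mul (.ofNat (.var 4)) (.var 2)) (.const 2))
    (.seq (.assignNat 4 (.add (.var 4) (.const 1))) (.assignNat 5 (.add (.var 5) (.var 2))))

/-- Take the (zero) initial means as the best ones. -/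
def initProg : Program :=
  .seq costProg (.assignReal 6 (.var 8))

/-! ### Correctness and running time of the programs -/

section Specifications

variable {ω : ℕ → unitInterval}

theorem sqDistProg_spec (s : State) :
    HaltsIn ω sqDistProg s ((s.nat 1 0 0 + 1) * 100)
      (fun s' => s'.real 7 0 0 =
        sqDist (s.nat 1 0 0) (s.real 0) (s.real 5) (s.nat 13 0 0) (s.nat 10 0 0)) := by
  refine (HaltsIn.seq (T' := (s.nat 1 0 0 + 1) * (30 + 3 + 18)) (HaltsIn.setReal
    (Q := fun s' => s'.real 7 0 0 = 0) (by simp [State.writeReal])) fun s₁ hf₁ h₁ => ?_).mono_time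
      (by simp; omega)
  refine HaltsIn.forLoop (fun i s' => s'.real 7 0 0 =
    sqDist i (s.real 0) (s.real 5) (s.nat 13 0 0) (s.nat 10 0 0)) (by decide) ?_ ?_ ?_ ?_
  · intro s' hf
    simp [hf.nat 1 (by decide), hf₁.nat 1 (by decide)]
  · simp [sqDist, h₁]
  · exact fun _ _ _ h => h
  · intro i hi s' hf hv hJ
    have hF : Frame sqDistProg s s' := hf₁.seqLeft.trans hf.seqRight
    refine (HaltsIn.setReal ?_).mono_time (by simp)
    have e1 := hF.nat 13 (by decide)
    have e2 := hF.nat 10 (by decide)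
    have e3 := hF.real 0 (by decide)
    have e4 := hF.real 5 (by decide)
    rw [sqDist] at *
    simp [State.writeReal, Finset.sum_range_succ, hJ, hv, e1, e2, e3, e4]

/-- Variable `14` is a flag raised when some mean coincides with the point. The sum then contains a
meaningless term, and `costProg` skips the point. -/
theorem pointProg_spec (s : State) :
    HaltsIn ω pointProg s ((s.nat 2 0 0 + 1) * ((s.nat 1 0 0 + 1) * 200))
      (fun s' => s'.real 9 0 0 = ∑ k ∈ Finset.range (s.nat 2 0 0),
          1 / root (sqDist (s.nat 1 0 0) (s.real 0) (s.real 5) (s.nat 13 0 0) k)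
            (s.nat 3 0 0 - 1) ∧
        (s'.nat 14 0 0 < 1 ↔ ∀ k < s.nat 2 0 0,
          0 < sqDist (s.nat 1 0 0) (s.real 0) (s.real 5) (s.nat 13 0 0) k)) := by
  refine (HaltsIn.seq (T' := 4 + (s.nat 2 0 0 + 1) * (((s.nat 1 0 0 + 1) * 100 + 40) + 3 + 18))
    (HaltsIn.setReal (Q := fun s' => s'.real 9 0 0 = 0) (by simp [State.writeReal]))
    fun s₁ hf₁ h₁ => ?_).mono_time (by simp; nlinarith)
  refine HaltsIn.seq (HaltsIn.setNat (Q := fun s' => s'.real 9 0 0 = 0 ∧ s'.nat 14 0 0 = 0)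
    ⟨h₁, by simp [State.writeNat]⟩) fun s₂ hf₂ h₂ => ?_
  refine HaltsIn.forLoop (fun i s' => s'.real 9 0 0 = ∑ k ∈ Finset.range i,
          1 / root (sqDist (s.nat 1 0 0) (s.real 0) (s.real 5) (s.nat 13 0 0) k)
            (s.nat 3 0 0 - 1) ∧
        (s'.nat 14 0 0 < 1 ↔ ∀ k < i,
          0 < sqDist (s.nat 1 0 0) (s.real 0) (s.real 5) (s.nat 13 0 0) k))
      (by decide) ?_ ?_ ?_ ?_
  · intro s' hf
    have hF : Frame pointProg s s' := hf₁.seqLeft.trans (hf₂.seqLeft.trans hf.seqRight).seqRight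
    simp [hF.nat 2 (by decide)]
  · simp [h₂]
  · intro i c s' h
    simpa [State.writeNat] using h
  · intro i hi s' hf hv hJ
    have hF : Frame pointProg s s' := hf₁.seqLeft.trans (hf₂.seqLeft.trans hf.seqRight).seqRight
    have e1 := hF.nat 13 (by decide)
    have e2 := hF.nat 1 (by decide)
    have e3 := hF.real 0 (by decide)
    have e4 := hF.real 5 (by decide)
    have e5 := hF.nat 3 (by decide)
    refine (HaltsIn.seq (T' := 30) (sqDistProg_spec s') fun s₃ hf₃ h₃ => ?_).mono_time
      (by rw [e2]; omega)
    rw [hv, e1, e2, e3, e4] at h₃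
    refine (HaltsIn.seq (T' := 12) (HaltsIn.setReal (Q := fun s'' => s''.real 7 = s₃.real 7 ∧
      s''.nat 14 = s₃.nat 14 ∧ s''.real 9 0 0 = ∑ k ∈ Finset.range (i + 1),
          1 / root (sqDist (s.nat 1 0 0) (s.real 0) (s.real 5) (s.nat 13 0 0) k)
            (s.nat 3 0 0 - 1)) ⟨?_, rfl, ?_⟩) fun s₄ hf₄ h₄ => ?_).mono_time (by simp)
    · exact State.writeReal_real_of_ne (by decide)
    · simp [State.writeReal, Finset.sum_range_succ, hf₃.real 9 (by decide), hJ.1,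
        hf₃.nat 3 (by decide), e5, h₃]
    · have h14 : s₄.nat 14 = s'.nat 14 := h₄.2.1.trans (hf₃.nat 14 (by decide))
      refine (HaltsIn.ite (T := 4) (fun hb => HaltsIn.mono_time (.skip ?_) (by simp))
        (fun hb => HaltsIn.mono_time (.setNat ?_) (by simp))).mono_time (by simp)
      · have hb' : 0 < s₄.real 7 0 0 := by simpa using hb
        rw [h₄.1, h₃] at hb'
        refine ⟨h₄.2.2, ?_⟩
        rw [h14, hJ.2]
        refine ⟨fun h k hk => ?_, fun h k hk => h k (by omega)⟩
        rcases Nat.lt_succ_iff_lt_or_eq.1 hk with hk | rfl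
        exacts [h k hk, hb']
      · have hb' : ¬ 0 < s₄.real 7 0 0 := by simpa using hb
        rw [h₄.1, h₃] at hb'
        refine ⟨h₄.2.2, ?_⟩
        simp only [State.writeNat, NExpr.eval]
        simp only [and_self, if_true, lt_irrefl, false_iff]
        exact fun h => hb' (h i (Nat.lt_succ_self i))

theorem costProg_spec (s : State) :
    HaltsIn ω costProg s
      ((s.nat 0 0 0 + 1) * ((s.nat 2 0 0 + 1) * ((s.nat 1 0 0 + 1) * 300)))
      (fun s' => s'.real 8 0 0 = totalCost (s.nat 0 0 0) (s.nat 1 0 0) (s.nat 2 0 0) (s.nat 3 0 0)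
        (s.real 0) (fun n => s.real 1 n 0) (s.real 5)) := by
  refine (HaltsIn.seq (T' := (s.nat 0 0 0 + 1) *
      (((s.nat 2 0 0 + 1) * ((s.nat 1 0 0 + 1) * 200) + 50) + 3 + 18))
    (HaltsIn.setReal (Q := fun s' => s'.real 8 0 0 = 0) (by simp [State.writeReal]))
    fun s₁ hf₁ h₁ => ?_).mono_time ?_
  · refine HaltsIn.forLoop (fun i s' => s'.real 8 0 0 = totalCost i (s.nat 1 0 0) (s.nat 2 0 0)
      (s.nat 3 0 0) (s.real 0) (fun n => s.real 1 n 0) (s.real 5)) (by decide) ?_ ?_ ?_ ?_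
    · intro s' hf
      have hF : Frame costProg s s' := hf₁.seqLeft.trans hf.seqRight
      simp [hF.nat 0 (by decide)]
    · simp [h₁, totalCost]
    · exact fun _ _ _ h => h
    · intro i hi s' hf hv hJ
      have hF : Frame costProg s s' := hf₁.seqLeft.trans hf.seqRight
      have e1 := hF.nat 2 (by decide)
      have e2 := hF.nat 1 (by decide)
      have e3 := hF.real 0 (by decide)
      have e4 := hF.real 5 (by decide)
      have e5 := hF.nat 3 (by decide)
      have e6 := hF.real 1 (by decide)
      refine (HaltsIn.seq (T' := 40) (pointProg_spec s') fun s₃ hf₃ h₃ => ?_).mono_time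
        (by rw [e1, e2]; omega)
      rw [hv, e1, e2, e3, e4, e5] at h₃
      have h8 : s₃.real 8 = s'.real 8 := hf₃.real 8 (by decide)
      rw [totalCost] at *
      rw [Finset.sum_range_succ, pointCost]
      refine (HaltsIn.ite (T := 30) (fun hb => HaltsIn.mono_time (.setReal ?_) (by simp))
        (fun hb => HaltsIn.mono_time (.skip ?_) (by simp))).mono_time (by simp)
      · have hb' : s₃.nat 14 0 0 < 1 := by simpa using hb
        rw [if_pos (h₃.2.1 hb')]
        simp [State.writeReal, h₃.1, h8, hJ, hf₃.nat 13 (by decide), hv,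
          hf₃.nat 3 (by decide), e5, hf₃.real 1 (by decide), e6]
      · have hb' : ¬ s₃.nat 14 0 0 < 1 := by simpa using hb
        rw [if_neg fun h => hb' (h₃.2.2 h), h8, hJ, mul_zero, add_zero]
  · have : 1 ≤ (s.nat 2 0 0 + 1) * (s.nat 1 0 0 + 1) := Nat.mul_pos (by omega) (by omega)
    simp
    nlinarith

theorem coordProg_spec (s : State) :
    HaltsIn ω coordProg s ((s.nat 4 0 0 + 1) * 100)
      (fun s' => s'.real 5 = (s.writeReal 5 (s.nat 10 0 0) (s.nat 11 0 0)
        ((∑ i ∈ Finset.range (s.nat 4 0 0),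
          s.real 0 (s.nat 7 (s.nat 9 0 0 + i) 0) (s.nat 11 0 0)) / (s.nat 4 0 0 : ℝ))).real 5) := by
  refine (HaltsIn.seq (T' := (s.nat 4 0 0 + 1) * (30 + 21) + 20) (HaltsIn.setReal
    (Q := fun s' => s'.real 7 0 0 = 0) (by simp [State.writeReal])) fun s₁ hf₁ h₁ => ?_).mono_time
      (by simp; omega)
  refine (HaltsIn.seq (T' := 20) (T := (s.nat 4 0 0 + 1) * (30 + 21)) (HaltsIn.forLoop
    (n := s.nat 4 0 0) (T := 30)
    (fun i s' => s'.real 7 0 0 = ∑ i' ∈ Finset.range i,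
      s.real 0 (s.nat 7 (s.nat 9 0 0 + i') 0) (s.nat 11 0 0)) (by decide) ?_ (by simp [h₁])
    (fun _ _ _ h => h) ?_) ?_)
  · intro s' hf
    simp [hf.nat 4 (by decide), hf₁.nat 4 (by decide)]
  · intro i hi s' hf hv hJ
    refine HaltsIn.mono_time (.setReal ?_) (by simp)
    have e1 : s'.nat 9 = s.nat 9 := (hf.nat 9 (by decide)).trans (hf₁.nat 9 (by decide))
    have e2 : s'.nat 7 = s.nat 7 := (hf.nat 7 (by decide)).trans (hf₁.nat 7 (by decide))
    have e3 : s'.nat 11 = s.nat 11 := (hf.nat 11 (by decide)).trans (hf₁.nat 11 (by decide))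
    have e4 : s'.real 0 = s.real 0 := (hf.real 0 (by decide)).trans (hf₁.real 0 (by decide))
    simp [State.writeReal, Finset.sum_range_succ, hJ, hv, e1, e2, e3, e4]
  · intro s' hf hJ
    refine HaltsIn.mono_time (.setReal ?_) (by simp)
    have e1 : s'.nat 10 = s.nat 10 := (hf.nat 10 (by decide)).trans (hf₁.nat 10 (by decide))
    have e2 : s'.nat 4 = s.nat 4 := (hf.nat 4 (by decide)).trans (hf₁.nat 4 (by decide))
    have e3 : s'.nat 11 = s.nat 11 := (hf.nat 11 (by decide)).trans (hf₁.nat 11 (by decide))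
    have e4 : s'.real 5 = s.real 5 := (hf.real 5 (by decide)).trans (hf₁.real 5 (by decide))
    simp only [RExpr.eval, NExpr.eval, State.writeReal, hJ, e1, e2, e3, e4]

theorem meanProg_spec (s : State) :
    HaltsIn ω meanProg s ((s.nat 1 0 0 + 1) * ((s.nat 4 0 0 + 1) * 150))
      (fun s' => (∀ k ≠ s.nat 10 0 0, s'.real 5 k = s.real 5 k) ∧
        ∀ d < s.nat 1 0 0, s'.real 5 (s.nat 10 0 0) d =
          (∑ i ∈ Finset.range (s.nat 4 0 0),
            s.real 0 (s.nat 7 (s.nat 9 0 0 + i) 0) d) / (s.nat 4 0 0 : ℝ)) := by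
  refine (HaltsIn.forLoop (n := s.nat 1 0 0) (T := (s.nat 4 0 0 + 1) * 100)
    (fun d s' => (∀ k ≠ s.nat 10 0 0, s'.real 5 k = s.real 5 k) ∧
      ∀ d' < d, s'.real 5 (s.nat 10 0 0) d' =
        (∑ i ∈ Finset.range (s.nat 4 0 0),
          s.real 0 (s.nat 7 (s.nat 9 0 0 + i) 0) d') / (s.nat 4 0 0 : ℝ))
    (by decide) ?_ (by simp) (fun _ _ _ h => h) ?_).mono_time (by simp; nlinarith)
  · intro s' hf
    simp [hf.nat 1 (by decide)]
  · intro d hd s' hf hv hJ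
    have e1 : s'.nat 10 = s.nat 10 := hf.nat 10 (by decide)
    have e2 : s'.nat 4 = s.nat 4 := hf.nat 4 (by decide)
    have e3 : s'.nat 9 = s.nat 9 := hf.nat 9 (by decide)
    have e4 : s'.real 0 = s.real 0 := hf.real 0 (by decide)
    have e5 : s'.nat 7 = s.nat 7 := hf.nat 7 (by decide)
    refine (coordProg_spec s').mono (by rw [e2]) fun s'' _ h => ?_
    rw [e1, e2, e3, e4, e5, hv] at h
    refine ⟨fun k hk => ?_, fun d' hd' => ?_⟩
    · rw [h, ← hJ.1 k hk]
      funext j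
      simp [State.writeReal, hk]
    · rw [h]
      rcases Nat.lt_succ_iff_lt_or_eq.1 hd' with hd' | rfl
      · simp [State.writeReal, hd'.ne, hJ.2 d' hd']
      · simp [State.writeReal]

theorem meansProg_spec (s : State) :
    HaltsIn ω meansProg s
      ((s.nat 2 0 0 + 1) * ((s.nat 1 0 0 + 1) * ((s.nat 4 0 0 + 1) * 200)))
      (fun s' => ∀ k < s.nat 2 0 0, ∀ d < s.nat 1 0 0, s'.real 5 k d =
        sampleMeans (s.nat 4 0 0) (s.real 0) (fun j => s.nat 7 j 0) k d) := by
  set K := s.nat 2 0 0 with hK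
  set D := s.nat 1 0 0 with hD
  set S := s.nat 4 0 0 with hS
  refine (HaltsIn.seq (T' := (K + 1) * (((D + 1) * ((S + 1) * 150) + 10) + 3 + 18))
    (HaltsIn.setNat (Q := fun s' => s'.nat 9 0 0 = 0) (by simp [State.writeNat]))
    fun s₁ hf₁ h₁ => ?_).mono_time ?_
  -- Variable `9` carries the offset `k * S` of the current group of samples, again obtained by
  -- repeated addition.
  · refine (HaltsIn.forLoop (fun k s' => s'.nat 9 0 0 = k * S ∧ ∀ k' < k, ∀ d < D,
      s'.real 5 k' d = sampleMeans S (s.real 0) (fun j => s.nat 7 j 0) k' d)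
      (by decide) ?_ ?_ ?_ ?_).mono le_rfl fun _ _ h => h.2
    · intro s' hf
      have hF : Frame meansProg s s' := hf₁.seqLeft.trans hf.seqRight
      simp [hF.nat 2 (by decide), hK]
    · simp [h₁]
    · intro i c s' h
      simpa [State.writeNat] using h
    · intro k hk s₂ hf₂ hv₂ hJ₂
      have hF₂ : Frame meansProg s s₂ := hf₁.seqLeft.trans hf₂.seqRight
      have e1 : s₂.nat 1 = s.nat 1 := hF₂.nat 1 (by decide)
      have e2 : s₂.nat 4 = s.nat 4 := hF₂.nat 4 (by decide)
      have e3 : s₂.nat 7 = s.nat 7 := hF₂.nat 7 (by decide)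
      have e4 : s₂.real 0 = s.real 0 := hF₂.real 0 (by decide)
      refine (HaltsIn.seq (T' := 10) (meanProg_spec s₂) ?_).mono_time (by rw [e1, e2])
      intro s₃ hf₃ hJ₃
      rw [e1, e2, e3, e4, hv₂, hJ₂.1] at hJ₃
      refine HaltsIn.mono_time (.setNat ⟨?_, fun k' hk' d hd => ?_⟩) (by simp)
      · simp [State.writeNat, hf₃.nat 9 (by decide), hf₃.nat 4 (by decide), hJ₂.1,
          e2, ← hS, Nat.succ_mul]
      · change s₃.real 5 k' d = _
        rcases Nat.lt_succ_iff_lt_or_eq.1 hk' with hk' | rfl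
        · rw [hJ₃.1 k' hk'.ne, hJ₂.2 k' hk' d hd]
        · exact hJ₃.2 d hd
  · have : 1 ≤ (D + 1) * (S + 1) := Nat.mul_pos (by omega) (by omega)
    simp
    nlinarith

theorem copyProg_spec (s : State) :
    HaltsIn ω copyProg s ((s.nat 2 0 0 + 1) * ((s.nat 1 0 0 + 1) * 100))
      (fun s' => ∀ k < s.nat 2 0 0, ∀ d < s.nat 1 0 0, s'.real 4 k d = s.real 5 k d) := by
  refine (HaltsIn.forLoop (n := s.nat 2 0 0) (T := (s.nat 1 0 0 + 1) * (30 + 21))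
    (fun k s' => ∀ k' < k, ∀ d < s.nat 1 0 0, s'.real 4 k' d = s.real 5 k' d)
    (by decide) ?_ (by simp) (fun _ _ _ h => h) ?_).mono_time (by simp; nlinarith)
  · intro s' hf
    simp [hf.nat 2 (by decide)]
  · intro k hk s₂ hf₂ hv₂ hJ₂
    refine (HaltsIn.forLoop (n := s.nat 1 0 0) (T := 30)
      (fun i s' => (∀ k' < k, ∀ d < s.nat 1 0 0, s'.real 4 k' d = s.real 5 k' d) ∧
        ∀ d < i, s'.real 4 k d = s.real 5 k d)
      (by decide) ?_ ⟨hJ₂, by simp⟩ (fun _ _ _ h => h) ?_).mono le_rfl ?_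
    · intro s' hf
      simp [hf.nat 1 (by decide), hf₂.nat 1 (by decide)]
    · intro d hd s₃ hf₃ hv₃ hJ₃
      have h10 : s₃.nat 10 0 0 = k := by rw [hf₃.nat 10 (by decide), hv₂]
      refine HaltsIn.mono_time (.setReal ⟨fun k' hk' d' hd' => ?_, fun d' hd' => ?_⟩) (by simp)
      · simp [State.writeReal, h10, hk'.ne, hJ₃.1 k' hk' d' hd']
      · rcases Nat.lt_succ_iff_lt_or_eq.1 hd' with hd' | rfl
        · simp [State.writeReal, h10, hv₃, hd'.ne, hJ₃.2 d' hd']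
        · simp [State.writeReal, h10, hv₃, hf₃.real 5 (by decide), hf₂.real 5 (by decide)]
    · intro s₃ hf₃ hJ₃ k' hk' d hd
      rcases Nat.lt_succ_iff_lt_or_eq.1 hk' with hk' | rfl
      exacts [hJ₃.1 k' hk' d hd, hJ₃.2 d hd]

/-! ### Generators of samples, and the two algorithms -/

/-- The index chosen by the number `u ∈ [0,1]` among `0, …, N - 1`, with probabilities
proportional to the weights. -/
def pick (N : ℕ) (w : ℕ → ℝ) (u : ℝ) : ℕ :=
  ((Finset.range (N - 1)).filter fun n =>
    ∑ i ∈ Finset.range (n + 1), w i ≤ u * ∑ i ∈ Finset.range N, w i).card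

/-- The total weight of the points. -/
def weightProg : Program :=
  .forLoop 13 (.var 0) (.assignReal 11 (.add (.var 11) (.cell 1 (.var 13) (.const 0))))

/-- Compare the scaled random number (variable `10`) with the partial sums of the weights. -/
def scanProg : Program :=
  .forLoop 13 (.sub (.var 0) (.const 1))
    (.seq (.assignReal 7 (.add (.var 7) (.cell 1 (.var 13) (.const 0))))
      (.ite (.realLT (.var 10) (.var 7)) .skip (.assignNat 15 (.add (.var 15) (.const 1)))))

/-- Draw one sample, at position `j` (variable `8`). -/
def drawProg : Program :=
  .seq (.draw 10 (.const 0) (.const 0))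
    (.seq (.assignReal 10 (.mul (.var 10) (.var 11)))
      (.seq (.assignReal 7 (.const 0))
        (.seq (.assignNat 15 (.const 0))
          (.seq scanProg (.setNat 7 (.var 8) (.const 0) (.var 15))))))

/-- Draw all samples of one trial. -/
def drawsProg : Program :=
  .forLoop 8 (.var 5) drawProg

/-- Increment digit `j` (variable `8`) if the carry (variable `15`) is positive. -/
def digitProg : Program :=
  .ite (.natLT (.const 0) (.var 15))
    (.ite (.natLT (.add (.cell 7 (.var 8) (.const 0)) (.const 1)) (.var 0))
      (.seq (.setNat 7 (.var 8) (.const 0) (.add (.cell 7 (.var 8) (.const 0)) (.const 1)))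
        (.assignNat 15 (.const 0)))
      (.setNat 7 (.var 8) (.const 0) (.const 0)))
    .skip

/-- Increment the number in base `N` whose digits are the indices of the samples. -/
def incrementProg : Program :=
  .seq (.assignNat 15 (.const 1)) (.forLoop 8 (.var 5) digitProg)

/-- The randomized algorithm. -/
def randomProg : Program :=
  -- The number of trials `(2 / α^S)^K` is the inverse of the lower bound `(α^S / 2)^K` for the
  -- success probability of one trial.
  .seq sizeProg (.seq weightProg (.seq initProg (searchProg drawsProg
    (.pow (.div (.const 2) (.pow (.var 3) (.var 4))) (.var 2)))))

/-- The deterministic algorithm. -/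
def exhaustiveProg : Program :=
  .seq sizeProg (.seq initProg (searchProg incrementProg (.pow (.ofNat (.var 0)) (.var 5))))

/-- The cost of means `C` for the input held by the state `s`. -/
def State.costOf (s : State) (C : ℕ → ℕ → ℝ) : ℝ :=
  totalCost (s.nat 0 0 0) (s.nat 1 0 0) (s.nat 2 0 0) (s.nat 3 0 0) (s.real 0)
    (fun n => s.real 1 n 0) C

theorem State.costOf_eq {s s' : State} (hn : ∀ a < 6, s'.nat a = s.nat a)
    (h0 : s'.real 0 = s.real 0) (h1 : s'.real 1 = s.real 1) : s'.costOf = s.costOf := by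
  funext C
  rw [State.costOf, State.costOf, hn 0 (by decide), hn 1 (by decide), hn 2 (by decide),
    hn 3 (by decide), h0, h1]

/-- The stored cost always equals the cost of the output array. This turns the minimum over all
trials into a bound for the returned means. -/
theorem updateProg_spec (s : State) (h6 : s.real 6 0 0 = s.costOf (s.real 4))
    (h8 : s.real 8 0 0 = s.costOf (s.real 5)) :
    HaltsIn ω updateProg s ((s.nat 2 0 0 + 1) * ((s.nat 1 0 0 + 1) * 200))
      (fun s' => s'.real 6 0 0 = s.costOf (s'.real 4) ∧ s'.real 6 0 0 ≤ s.real 6 0 0 ∧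
        s'.real 6 0 0 ≤ s.real 8 0 0) := by
  have hp : 1 ≤ (s.nat 2 0 0 + 1) * (s.nat 1 0 0 + 1) := Nat.mul_pos (by omega) (by omega)
  refine (HaltsIn.ite (T := 6 + (s.nat 2 0 0 + 1) * ((s.nat 1 0 0 + 1) * 100)) (fun hb => ?_)
    (fun hb => HaltsIn.mono_time (.skip ⟨h6, le_rfl, ?_⟩) (by omega))).mono_time
      (by simp; nlinarith)
  · refine HaltsIn.seq (HaltsIn.mono_time (HaltsIn.setReal
      (Q := fun s' => s'.real 6 0 0 = s.real 8 0 0) (by simp [State.writeReal])) (by simp))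
      fun s₁ hf₁ h₁ => ?_
    have hb' : s.real 8 0 0 < s.real 6 0 0 := by simpa using hb
    have e1 : s₁.nat 1 = s.nat 1 := hf₁.nat 1 (by decide)
    have e2 : s₁.nat 2 = s.nat 2 := hf₁.nat 2 (by decide)
    refine (copyProg_spec s₁).mono (by rw [e1, e2]) fun s₂ hf₂ h₂ => ?_
    have e6 : s₂.real 6 0 0 = s.real 8 0 0 := by rw [hf₂.real 6 (by decide), h₁]
    refine ⟨?_, e6.trans_le hb'.le, e6.le⟩
    rw [e6, h8]
    refine totalCost_congr fun k hk d hd => ?_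
    rw [h₂ k (by rwa [e2]) d (by rwa [e1]), hf₁.real 5 (by decide)]
  · simpa using hb

theorem trialProg_spec (s : State) (h6 : s.real 6 0 0 = s.costOf (s.real 4)) :
    HaltsIn ω trialProg s ((s.nat 2 0 0 + 1) * ((s.nat 1 0 0 + 1) *
        ((s.nat 4 0 0 + 1) * ((s.nat 0 0 0 + 1) * 700))))
      (fun s' => s'.real 6 0 0 = s.costOf (s'.real 4) ∧ s'.real 6 0 0 ≤ s.real 6 0 0 ∧
        s'.real 6 0 0 ≤ s.costOf
          (sampleMeans (s.nat 4 0 0) (s.real 0) fun j => s.nat 7 j 0)) := by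
  refine (HaltsIn.seq (T' := (s.nat 0 0 0 + 1) * ((s.nat 2 0 0 + 1) * ((s.nat 1 0 0 + 1) * 300)) +
      (s.nat 2 0 0 + 1) * ((s.nat 1 0 0 + 1) * 200)) (meansProg_spec s) fun s₁ hf₁ h₁ =>
    HaltsIn.seq ((costProg_spec s₁).mono_time ?_) fun s₂ hf₂ h₂ => (updateProg_spec s₂ ?_ ?_).mono
      ?_ ?_).mono_time ?_
  · rw [hf₁.nat 0 (by decide), hf₁.nat 1 (by decide), hf₁.nat 2 (by decide)]
  · rw [hf₂.real 6 (by decide), hf₁.real 6 (by decide), hf₂.real 4 (by decide),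
      hf₁.real 4 (by decide), State.costOf, hf₂.nat 0 (by decide), hf₂.nat 1 (by decide),
      hf₂.nat 2 (by decide), hf₂.nat 3 (by decide), hf₂.real 0 (by decide),
      hf₂.real 1 (by decide), hf₁.nat 0 (by decide), hf₁.nat 1 (by decide),
      hf₁.nat 2 (by decide), hf₁.nat 3 (by decide), hf₁.real 0 (by decide),
      hf₁.real 1 (by decide)]
    exact h6
  · rw [h₂, State.costOf, hf₂.nat 0 (by decide), hf₂.nat 1 (by decide),
      hf₂.nat 2 (by decide), hf₂.nat 3 (by decide), hf₂.real 0 (by decide),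
      hf₂.real 1 (by decide), hf₂.real 5 (by decide)]
  · rw [hf₂.nat 1 (by decide), hf₂.nat 2 (by decide), hf₁.nat 1 (by decide),
      hf₁.nat 2 (by decide)]
  · intro s₃ hf₃ h₃
    have hc : s₂.costOf = s.costOf := by
      funext C
      rw [State.costOf, hf₂.nat 0 (by decide), hf₂.nat 1 (by decide),
        hf₂.nat 2 (by decide), hf₂.nat 3 (by decide), hf₂.real 0 (by decide),
        hf₂.real 1 (by decide), hf₁.nat 0 (by decide), hf₁.nat 1 (by decide),
        hf₁.nat 2 (by decide), hf₁.nat 3 (by decide), hf₁.real 0 (by decide),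
        hf₁.real 1 (by decide), State.costOf]
    rw [hc, h₂, hf₂.real 6 (by decide), hf₁.real 6 (by decide), hf₁.nat 0 (by decide),
      hf₁.nat 1 (by decide), hf₁.nat 2 (by decide), hf₁.nat 3 (by decide),
      hf₁.real 0 (by decide), hf₁.real 1 (by decide)] at h₃
    exact ⟨h₃.1, h₃.2.1, h₃.2.2.trans_eq (totalCost_congr h₁)⟩
  · generalize s.nat 0 0 0 = N
    generalize s.nat 1 0 0 = D
    generalize s.nat 2 0 0 = K
    generalize s.nat 4 0 0 = S
    calc _ = (K + 1) * (D + 1) * ((S + 1) * 200 + (N + 1) * 300 + 200) := by ring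
      _ ≤ (K + 1) * (D + 1) * ((S + 1) * ((N + 1) * 700)) :=
        Nat.mul_le_mul_left _ (by nlinarith [Nat.zero_le (S * N)])
      _ = _ := by ring

/-- Programs that are admitted as generators of samples in `searchProg`. -/
structure IsGenerator (gen : Program) : Prop where
  nat : gen.natWrites ⊆ [7, 8, 13, 15]
  real : gen.realWrites ⊆ [7, 10]

theorem IsGenerator.nat_eq {gen : Program} (h : IsGenerator gen) {s s' : State}
    (hf : Frame gen s s') : ∀ a < 7, s'.nat a = s.nat a := by
  intro a ha
  refine hf.nat a fun h' => ?_
  have := h.nat h'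
  clear h'
  revert a
  decide

theorem IsGenerator.real_eq {gen : Program} (h : IsGenerator gen) {s s' : State}
    (hf : Frame gen s s') : ∀ a < 7, s'.real a = s.real a := by
  intro a ha
  refine hf.real a fun h' => ?_
  have := h.real h'
  clear h'
  revert a
  decide

theorem IsGenerator.search_nat_eq {gen : Program} (h : IsGenerator gen) {B : RExpr} {s s' : State}
    (hf : Frame (searchProg gen B) s s') : ∀ a < 6, s'.nat a = s.nat a := by
  intro a ha
  have hg : gen.natWrites ⊆ [6, 7, 8, 9, 10, 11, 12, 13, 14, 15] := List.Subset.trans h.nat (by decide)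
  have ht : (Program.seq trialProg (.assignNat 6 (.add (.var 6) (.const 1)))).natWrites ⊆
    [6, 7, 8, 9, 10, 11, 12, 13, 14, 15] := by decide
  refine hf.nat a fun h' => ?_
  have := List.append_subset.2 ⟨hg, ht⟩ h'
  simp only [List.mem_cons, List.not_mem_nil, or_false] at this
  omega

theorem IsGenerator.search_real_eq {gen : Program} (h : IsGenerator gen) {B : RExpr}
    {s s' : State} (hf : Frame (searchProg gen B) s s') {a : ℕ} (ha : a < 4 ∨ 11 ≤ a) :
    s'.real a = s.real a := by
  have hg : gen.realWrites ⊆ [4, 5, 6, 7, 8, 9, 10] := List.Subset.trans h.real (by decide)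
  have ht : (Program.seq trialProg (.assignNat 6 (.add (.var 6) (.const 1)))).realWrites ⊆
    [4, 5, 6, 7, 8, 9, 10] := by decide
  refine hf.real a fun h' => ?_
  have := List.append_subset.2 ⟨hg, ht⟩ h'
  simp only [List.mem_cons, List.not_mem_nil, or_false] at this
  omega

/-- Here `G t` is what the generator needs to remember after `t` trials, and `f t` lists the samples
of trial `t`. Random and exhaustive search differ only in these data: the number of draws so far, or
the digits of a counter. -/
theorem searchProg_spec {gen : Program} (hgen : IsGenerator gen) {B : RExpr} (s : State) {β : ℝ}
    (hB : ∀ s', Frame (searchProg gen B) s s' → B.eval s' = β) (G : ℕ → State → Prop)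
    (f : ℕ → ℕ → ℕ) {Tg : ℕ} (h0 : s.nat 6 0 0 = 0) (hG0 : G 0 s)
    (h6 : s.real 6 0 0 = s.costOf (s.real 4))
    (hG : ∀ t s s', Frame (.seq trialProg (.assignNat 6 (.add (.var 6) (.const 1)))) s s' →
      G t s → G t s')
    (hg : ∀ t s', Frame (searchProg gen B) s s' → G t s' → HaltsIn ω gen s' Tg
      (fun s'' => G (t + 1) s'' ∧ ∀ j < s.nat 2 0 0 * s.nat 4 0 0, s''.nat 7 j 0 = f t j)) :
    HaltsIn ω (searchProg gen B) s
      ((⌈β⌉₊ + 1) * (Tg + B.time + (s.nat 2 0 0 + 1) * ((s.nat 1 0 0 + 1) *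
        ((s.nat 4 0 0 + 1) * ((s.nat 0 0 0 + 1) * 800)))))
      (fun s' => ∀ t < ⌈β⌉₊, s.costOf (s'.real 4) ≤
        s.costOf (sampleMeans (s.nat 4 0 0) (s.real 0) (f t))) := by
  set V := (s.nat 2 0 0 + 1) * ((s.nat 1 0 0 + 1) * ((s.nat 4 0 0 + 1) * (s.nat 0 0 0 + 1)))
    with hV
  have hV1 : 1 ≤ V := by
    rw [hV]
    exact Nat.mul_pos (by omega) (Nat.mul_pos (by omega) (Nat.mul_pos (by omega) (by omega)))
  refine (HaltsIn.loop (n := ⌈β⌉₊) (T := Tg + (V * 700 + 8)) (fun t s' => s'.nat 6 0 0 = t ∧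
    G t s' ∧ s'.real 6 0 0 = s.costOf (s'.real 4) ∧ ∀ t' < t, s'.real 6 0 0 ≤
      s.costOf (sampleMeans (s.nat 4 0 0) (s.real 0) (f t'))) ⟨h0, hG0, h6, by simp⟩ ?_ ?_).mono
        ?_ ?_
  · intro t ht s' hf hJ
    refine ⟨?_, HaltsIn.seq (hg t s' hf hJ.2.1) fun s₁ hf₁ h₁ => ?_⟩
    · simp [hJ.1, hB s' hf]
      exact Nat.lt_ceil.1 ht
    · have hF : Frame (searchProg gen B) s s₁ := hf.trans hf₁.seqLeft.loop
      have en := hgen.search_nat_eq hF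
      have e0 : s₁.real 0 = s.real 0 := hgen.search_real_eq hF (by decide)
      have e1 : s₁.real 1 = s.real 1 := hgen.search_real_eq hF (by decide)
      have ec : s₁.costOf = s.costOf := State.costOf_eq en e0 e1
      have e6 : s₁.real 6 = s'.real 6 := hgen.real_eq hf₁ 6 (by decide)
      refine HaltsIn.seq ((trialProg_spec s₁ ?_).mono_time ?_) fun s₂ hf₂ h₂ =>
        HaltsIn.mono_time (.setNat ⟨?_, hG _ _ _ ⟨fun a ha => ?_, fun a ha => ?_, fun h => ?_⟩ h₁.1,
          ?_, ?_⟩) (by simp)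
      · rw [ec, e6, hgen.real_eq hf₁ 4 (by decide), hJ.2.2.1]
      · rw [en 0 (by decide), en 1 (by decide), en 2 (by decide), en 4 (by decide), hV]
        exact le_of_eq (by ring)
      · simp [State.writeNat, hf₂.nat 6 (by decide), hgen.nat_eq hf₁ 6 (by decide), hJ.1]
      · rw [State.writeNat_nat_of_ne, hf₂.nat a fun h' => ha (List.mem_append_left _ h')]
        rintro rfl
        exact ha (by decide)
      · exact hf₂.real a fun h' => ha (List.mem_append_left _ h')
      · exact hf₂.drawn h.1
      · rw [ec] at h₂
        exact h₂.1
      · rw [ec, e6, en 4 (by decide), e0] at h₂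
        intro t' ht'
        change s₂.real 6 0 0 ≤ _
        rcases Nat.lt_succ_iff_lt_or_eq.1 ht' with ht' | rfl
        · exact h₂.2.1.trans (hJ.2.2.2 t' ht')
        · refine h₂.2.2.trans_eq (totalCost_congr fun k hk d _ => ?_)
          exact sampleMeans_congr h₁.2 hk d
  · intro s' hf hJ
    simp only [BExpr.Holds, RExpr.eval, NExpr.eval, hJ.1, hB s' hf, not_lt]
    exact Nat.le_ceil β
  · have : (s.nat 2 0 0 + 1) * ((s.nat 1 0 0 + 1) * ((s.nat 4 0 0 + 1) *
        ((s.nat 0 0 0 + 1) * 800))) = V * 800 := by rw [hV]; ring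
    rw [this]
    simp only [BExpr.time, RExpr.time, NExpr.time]
    nlinarith
  · intro s' hf h t ht
    rw [← h.2.2.1]
    exact h.2.2.2 t ht

theorem sizeProg_spec (s : State) (h4 : s.nat 4 0 0 = 0) (h5 : s.nat 5 0 0 = 0)
    (hε : 0 < s.real 2 0 0) :
    HaltsIn ω sizeProg s ((⌈2 / s.real 2 0 0⌉₊ + 1) * 50) (fun s' =>
      s'.nat 4 0 0 = ⌈2 / s.real 2 0 0⌉₊ ∧
        s'.nat 5 0 0 = s.nat 2 0 0 * ⌈2 / s.real 2 0 0⌉₊) := by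
  refine (HaltsIn.loop (n := ⌈2 / s.real 2 0 0⌉₊) (T := 30) (fun i s' => s'.nat 4 0 0 = i ∧
    s'.nat 5 0 0 = s.nat 2 0 0 * i) ⟨h4, by simp [h5]⟩ ?_ ?_).mono_time (by simp; omega)
  · intro i hi s' hf hJ
    have e1 := hf.nat 2 (by decide)
    have e2 := hf.real 2 (by decide)
    refine ⟨?_, ?_⟩
    · simp only [BExpr.Holds, RExpr.eval, NExpr.eval, hJ.1, e2]
      rw [← lt_div_iff₀ hε]
      exact_mod_cast Nat.lt_ceil.1 hi
    · refine HaltsIn.mono_time (HaltsIn.seq (HaltsIn.setNat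
        (Q := fun s'' => s''.nat 4 0 0 = i + 1) (by simp [State.writeNat, hJ.1]))
        fun s₁ hf₁ h₁ => .setNat ⟨?_, ?_⟩) (by simp)
      · simp [State.writeNat, h₁]
      · simp [State.writeNat, hf₁.nat 5 (by decide), hf₁.nat 2 (by decide), hJ.2, e1]
        ring
  · intro s' hf hJ
    simp only [BExpr.Holds, RExpr.eval, NExpr.eval, hJ.1, hf.real 2 (by decide), not_lt]
    rw [← div_le_iff₀ hε]
    exact_mod_cast Nat.le_ceil (2 / s.real 2 0 0)

/-- The cost program evaluates array `5`, whereas the output is array `4`; at this moment both are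
zero. The resulting value starts the invariant of the search. -/
theorem initProg_spec (s : State) (h : s.real 4 = s.real 5) :
    HaltsIn ω initProg s
      ((s.nat 0 0 0 + 1) * ((s.nat 2 0 0 + 1) * ((s.nat 1 0 0 + 1) * 300)) + 10)
      (fun s' => s'.real 6 0 0 = s.costOf (s.real 4)) := by
  refine HaltsIn.seq (costProg_spec s) fun s₁ hf₁ h₁ => HaltsIn.mono_time (.setReal ?_) (by simp)
  simp [State.writeReal, h₁, State.costOf, h]

theorem weightProg_spec (s : State) (h : s.real 11 0 0 = 0) :
    HaltsIn ω weightProg s ((s.nat 0 0 0 + 1) * 50)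
      (fun s' => s'.real 11 0 0 = ∑ n ∈ Finset.range (s.nat 0 0 0), s.real 1 n 0) := by
  refine (HaltsIn.forLoop (n := s.nat 0 0 0) (T := 20) (fun i s' => s'.real 11 0 0 =
    ∑ n ∈ Finset.range i, s.real 1 n 0) (by decide) ?_ (by simp [h]) (fun _ _ _ h => h)
      ?_).mono_time (by simp)
  · intro s' hf
    simp [hf.nat 0 (by decide)]
  · intro i hi s' hf hv hJ
    refine HaltsIn.mono_time (.setReal ?_) (by simp)
    simp [State.writeReal, Finset.sum_range_succ, hJ, hv, hf.real 1 (by decide)]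

theorem scanProg_spec (s : State) (h7 : s.real 7 0 0 = 0) (h15 : s.nat 15 0 0 = 0) :
    HaltsIn ω scanProg s ((s.nat 0 0 0 + 1) * 80)
      (fun s' => s'.nat 15 0 0 = ((Finset.range (s.nat 0 0 0 - 1)).filter fun n =>
        ∑ i ∈ Finset.range (n + 1), s.real 1 i 0 ≤ s.real 10 0 0).card) := by
  refine (HaltsIn.forLoop (n := s.nat 0 0 0 - 1) (T := 50)
    (fun i s' => s'.real 7 0 0 = ∑ n ∈ Finset.range i, s.real 1 n 0 ∧
      s'.nat 15 0 0 = ((Finset.range i).filter fun n =>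
        ∑ i ∈ Finset.range (n + 1), s.real 1 i 0 ≤ s.real 10 0 0).card) (by decide) ?_
      (by simp [h7, h15]) ?_ ?_).mono ?_ fun _ _ h => h.2
  · intro s' hf
    simp [hf.nat 0 (by decide)]
  · intro i c s' h
    simpa [State.writeNat] using h
  · intro i hi s' hf hv hJ
    refine (HaltsIn.seq (T' := 20) (HaltsIn.setReal (Q := fun s'' => s''.real 7 0 0 =
      ∑ n ∈ Finset.range (i + 1), s.real 1 n 0) ?_) fun s₁ hf₁ h₁ => ?_).mono_time (by simp)
    · simp [State.writeReal, Finset.sum_range_succ, hJ.1, hv, hf.real 1 (by decide)]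
    · have e1 : s₁.nat 15 0 0 = s'.nat 15 0 0 := by rw [hf₁.nat 15 (by decide)]
      have e2 : s₁.real 10 = s.real 10 :=
        (hf₁.real 10 (by decide)).trans (hf.real 10 (by decide))
      refine (HaltsIn.ite (T := 8) (fun hb => HaltsIn.mono_time (.skip ?_) (by simp))
        (fun hb => HaltsIn.mono_time (.setNat ?_) (by simp))).mono_time (by simp)
      · refine ⟨h₁, ?_⟩
        simp only [BExpr.Holds, RExpr.eval, NExpr.eval, h₁, e2] at hb
        rw [Finset.range_add_one, Finset.filter_insert, if_neg hb.not_ge, e1, hJ.2]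
      · refine ⟨h₁, ?_⟩
        simp only [BExpr.Holds, RExpr.eval, NExpr.eval, h₁, e2] at hb
        rw [Finset.range_add_one, Finset.filter_insert, if_pos (not_lt.1 hb),
          Finset.card_insert_of_notMem (by simp)]
        simp [State.writeNat, e1, hJ.2]
  · simp only [NExpr.time]
    nlinarith [Nat.sub_le (s.nat 0 0 0) 1]

theorem drawProg_spec (s : State)
    (h11 : s.real 11 0 0 = ∑ n ∈ Finset.range (s.nat 0 0 0), s.real 1 n 0) :
    HaltsIn ω drawProg s ((s.nat 0 0 0 + 1) * 120)
      (fun s' => s'.drawn = s.drawn + 1 ∧ s'.nat 7 = (s.writeNat 7 (s.nat 8 0 0) 0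
        (pick (s.nat 0 0 0) (fun n => s.real 1 n 0) (ω s.drawn))).nat 7) := by
  refine (HaltsIn.seq (T' := (s.nat 0 0 0 + 1) * 80 + 30) (HaltsIn.draw
    (Q := fun s' => s'.drawn = s.drawn + 1 ∧ s'.real 10 0 0 = ω s.drawn)
    (by simp [State.writeReal])) fun s₁ hf₁ h₁ => ?_).mono_time (by simp; omega)
  refine (HaltsIn.seq (T' := (s.nat 0 0 0 + 1) * 80 + 20) (HaltsIn.setReal
    (Q := fun s' => s'.drawn = s.drawn + 1 ∧ s'.real 10 0 0 = ω s.drawn * s.real 11 0 0)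
    ⟨h₁.1, ?_⟩) fun s₂ hf₂ h₂ => ?_).mono_time (by simp; omega)
  · simp [State.writeReal, h₁.2, hf₁.real 11 (by decide)]
  refine (HaltsIn.seq (T' := (s.nat 0 0 0 + 1) * 80 + 15) (HaltsIn.setReal
    (Q := fun s' => s'.real 7 0 0 = 0)
    (by simp [State.writeReal])) fun s₃ hf₃ h₃ => ?_).mono_time (by simp; omega)
  refine (HaltsIn.seq (T' := (s.nat 0 0 0 + 1) * 80 + 10) (HaltsIn.setNat
    (Q := fun s' => s'.nat 15 0 0 = 0 ∧ s'.real 7 0 0 = 0)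
    ⟨by simp [State.writeNat], h₃⟩) fun s₄ hf₄ h₄ => ?_).mono_time (by simp; omega)
  have en : ∀ a ≠ 15, s₄.nat a = s.nat a := fun a ha => by
    rw [hf₄.nat a (by simpa [Program.natWrites] using ha), hf₃.nat a (by simp [Program.natWrites]),
      hf₂.nat a (by simp [Program.natWrites]), hf₁.nat a (by simp [Program.natWrites])]
  have e1 : s₄.real 1 = s.real 1 := by
    rw [hf₄.real 1 (by decide), hf₃.real 1 (by decide), hf₂.real 1 (by decide),
      hf₁.real 1 (by decide)]
  have e10 : s₄.real 10 0 0 = ω s.drawn * s.real 11 0 0 := by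
    rw [hf₄.real 10 (by decide), hf₃.real 10 (by decide), h₂.2]
  have ed : s₄.drawn = s.drawn + 1 := by
    rw [hf₄.drawn trivial, hf₃.drawn trivial, h₂.1]
  refine (HaltsIn.seq ((scanProg_spec s₄ h₄.2 h₄.1).mono_time (by rw [en 0 (by decide)]))
    fun s₅ hf₅ h₅ => HaltsIn.mono_time (.setNat ⟨?_, ?_⟩) (by simp))
  · change s₅.drawn = _
    rw [hf₅.drawn (by simp [scanProg, Program.forLoop, Program.Deterministic]), ed]
  · rw [en 0 (by decide), e1, e10, h11] at h₅
    funext i j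
    simp [State.writeNat, h₅, pick, hf₅.nat 8 (by decide), en 8 (by decide),
      hf₅.nat 7 (by decide), en 7 (by decide)]

/-- Keeping track of the number of draws identifies the coordinates of `ω` behind each sample.
Different trials read disjoint coordinates, which later gives independence. -/
theorem drawsProg_spec (s : State)
    (h11 : s.real 11 0 0 = ∑ n ∈ Finset.range (s.nat 0 0 0), s.real 1 n 0) :
    HaltsIn ω drawsProg s ((s.nat 5 0 0 + 1) * ((s.nat 0 0 0 + 1) * 150))
      (fun s' => s'.drawn = s.drawn + s.nat 5 0 0 ∧ ∀ j < s.nat 5 0 0, s'.nat 7 j 0 =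
        pick (s.nat 0 0 0) (fun n => s.real 1 n 0) (ω (s.drawn + j))) := by
  refine (HaltsIn.forLoop (n := s.nat 5 0 0) (T := (s.nat 0 0 0 + 1) * 120)
    (fun i s' => s'.drawn = s.drawn + i ∧ ∀ j < i, s'.nat 7 j 0 =
        pick (s.nat 0 0 0) (fun n => s.real 1 n 0) (ω (s.drawn + j))) (by decide) ?_
      (by simp) ?_ ?_).mono_time (by simp; nlinarith)
  · intro s' hf
    simp [hf.nat 5 (by decide)]
  · intro i c s' h
    simpa [State.writeNat] using h
  · intro i hi s' hf hv hJ
    have e0 : s'.nat 0 = s.nat 0 := hf.nat 0 (by decide)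
    have e1 : s'.real 1 = s.real 1 := hf.real 1 (by decide)
    have e11 : s'.real 11 = s.real 11 := hf.real 11 (by decide)
    refine (drawProg_spec s' (by rw [e0, e1, e11, h11])).mono (by rw [e0]) fun s'' hf'' h => ?_
    rw [e0, e1, hv, hJ.1] at h
    refine ⟨by rw [h.1]; ring, fun j hj => ?_⟩
    rw [h.2]
    rcases Nat.lt_succ_iff_lt_or_eq.1 hj with hj | rfl
    · simp [State.writeNat, hj.ne, hJ.2 j hj]
    · simp [State.writeNat]

/-- A carry reaches digit `i` exactly when all lower digits of `t` are `N - 1`, that is, when `N ^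
i` divides `t + 1`. -/
theorem digit_succ {N t i : ℕ} (hN : 0 < N) :
    (t + 1) / N ^ i % N = (if N ^ i ∣ t + 1 then
      (if t / N ^ i % N + 1 < N then t / N ^ i % N + 1 else 0) else t / N ^ i % N) := by
  rw [Nat.succ_div]
  split_ifs with h h'
  · rw [Nat.add_mod, Nat.mod_eq_of_lt (a := t / N ^ i % N + 1 % N)]
    · rw [Nat.mod_eq_of_lt (a := 1) (by omega)]
    · rwa [Nat.mod_eq_of_lt (a := 1) (by omega)]
  · have := Nat.mod_lt (t / N ^ i) hN
    have e : t / N ^ i % N + 1 = N := by omega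
    rw [← Nat.mod_add_mod, e, Nat.mod_self]
  · rw [add_zero]

/-- The carry passes beyond digit `i` exactly when it arrives there and finds the digit `N - 1`. -/
theorem pow_succ_dvd_iff {N t i : ℕ} (hN : 0 < N) :
    N ^ (i + 1) ∣ t + 1 ↔ N ^ i ∣ t + 1 ∧ ¬ t / N ^ i % N + 1 < N := by
  have hp : 0 < N ^ i := Nat.pow_pos hN
  have hlt := Nat.mod_lt (t / N ^ i) hN
  constructor
  · intro h
    have h' : N ^ i ∣ t + 1 := (pow_dvd_pow N (Nat.le_succ i)).trans h
    refine ⟨h', fun hl => ?_⟩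
    have h0 : (t + 1) / N ^ i % N = 0 := by
      rw [← Nat.dvd_iff_mod_eq_zero]
      exact Nat.dvd_div_of_mul_dvd (by rwa [← pow_succ])
    rw [digit_succ hN, if_pos h', if_pos hl] at h0
    omega
  · rintro ⟨h, hl⟩
    have h0 : (t + 1) / N ^ i % N = 0 := by rw [digit_succ hN, if_pos h, if_neg hl]
    obtain ⟨c, hc⟩ := h
    rw [hc, Nat.mul_div_cancel_left _ hp] at h0
    rw [hc, pow_succ]
    exact Nat.mul_dvd_mul_left _ (Nat.dvd_of_mod_eq_zero h0)

theorem incrementProg_spec (s : State) {t : ℕ} (hN : 0 < s.nat 0 0 0)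
    (h : ∀ j < s.nat 5 0 0, s.nat 7 j 0 = t / s.nat 0 0 0 ^ j % s.nat 0 0 0) :
    HaltsIn ω incrementProg s ((s.nat 5 0 0 + 1) * 120)
      (fun s' => ∀ j < s.nat 5 0 0,
        s'.nat 7 j 0 = (t + 1) / s.nat 0 0 0 ^ j % s.nat 0 0 0) := by
  set N := s.nat 0 0 0 with hN'
  refine (HaltsIn.seq (HaltsIn.setNat (Q := fun s' => s'.nat 15 0 0 = 1)
    (by simp [State.writeNat])) fun s₁ hf₁ h₁ => (HaltsIn.forLoop (n := s.nat 5 0 0) (T := 60)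
      -- Positions below `i` already show the digits of `t + 1`, the others still those of `t`;
      -- variable `15` is the carry into position `i`.
      (fun i s' => (0 < s'.nat 15 0 0 ↔ N ^ i ∣ t + 1) ∧
        (∀ j < i, s'.nat 7 j 0 = (t + 1) / N ^ j % N) ∧
        ∀ j < s.nat 5 0 0, i ≤ j → s'.nat 7 j 0 = t / N ^ j % N)
      (by decide) ?_ ?_ ?_ ?_).mono le_rfl fun s' _ h => h.2.1).mono_time (by simp; omega)
  · intro s' hf
    simp [hf.nat 5 (by decide), hf₁.nat 5 (by decide)]
  · refine ⟨by simp [h₁], by simp, fun j hj _ => ?_⟩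
    rw [hf₁.nat 7 (by decide), h j hj]
  · intro i c s' h
    simpa [State.writeNat] using h
  · intro i hi s' hf hv hJ
    have e0 : s'.nat 0 0 0 = N := by rw [hf.nat 0 (by decide), hf₁.nat 0 (by decide)]
    have ei := hJ.2.2 i hi le_rfl
    have hds := digit_succ (t := t) (i := i) hN
    have hpd := pow_succ_dvd_iff (t := t) (i := i) hN
    refine (HaltsIn.ite (T := 40) (fun hb => (HaltsIn.ite (T := 20) (fun hc => ?_)
      (fun hc => ?_)).mono_time (by simp)) (fun hb => ?_)).mono_time (by simp)
    · have hb' : N ^ i ∣ t + 1 := hJ.1.1 (by simpa using hb)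
      have hc' : t / N ^ i % N + 1 < N := by simpa [hv, ei, e0] using hc
      refine HaltsIn.mono_time (HaltsIn.seq (HaltsIn.setNat (Q := fun s'' => s''.nat 7 =
        (s'.writeNat 7 i 0 (t / N ^ i % N + 1)).nat 7) ?_)
        fun s₂ hf₂ h₂ => .setNat ⟨?_, fun j hj => ?_, fun j hj hij => ?_⟩) (by simp)
      · simp [hv, ei]
      · simp [State.writeNat, hpd, hc']
      · rw [State.writeNat_nat_of_ne (by decide), h₂]
        rcases Nat.lt_succ_iff_lt_or_eq.1 hj with hj | rfl
        · simp [State.writeNat, hj.ne, hJ.2.1 j hj]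
        · simp [State.writeNat, hds, hb', hc']
      · rw [State.writeNat_nat_of_ne (by decide), h₂]
        simp [State.writeNat, (show j ≠ i by omega), hJ.2.2 j hj (by omega)]
    · have hb' : N ^ i ∣ t + 1 := hJ.1.1 (by simpa using hb)
      have hc' : ¬ t / N ^ i % N + 1 < N := by simpa [hv, ei, e0] using hc
      refine HaltsIn.mono_time (.setNat ⟨?_, fun j hj => ?_, fun j hj hij => ?_⟩) (by simp)
      · rw [State.writeNat_nat_of_ne (by decide), hJ.1, hpd]
        exact ⟨fun h => ⟨h, hc'⟩, And.left⟩
      · rcases Nat.lt_succ_iff_lt_or_eq.1 hj with hj | rfl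
        · simp [State.writeNat, hv, hj.ne, hJ.2.1 j hj]
        · simp [State.writeNat, hv, hds, hb', hc']
      · simp [State.writeNat, hv, (show j ≠ i by omega), hJ.2.2 j hj (by omega)]
    · have hb' : ¬ N ^ i ∣ t + 1 := fun h => hb (by simpa using hJ.1.2 h)
      refine HaltsIn.mono_time (.skip ⟨?_, fun j hj => ?_, fun j hj hij => ?_⟩) (by simp)
      · rw [hJ.1, hpd]
        exact ⟨fun h => absurd h hb', And.left⟩
      · rcases Nat.lt_succ_iff_lt_or_eq.1 hj with hj | rfl
        · exact hJ.2.1 j hj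
        · rw [hds, if_neg hb', ei]
      · exact hJ.2.2 j hj (by omega)

/-- In the state `s` all memory except the input is zero. -/
structure State.IsInitial (s : State) : Prop where
  nat : ∀ a, 4 ≤ a → ∀ i j, s.nat a i j = 0
  real : ∀ a, 4 ≤ a → ∀ i j, s.real a i j = 0
  drawn : s.drawn = 0

/-- The number of samples for each mean. -/
abbrev State.size (s : State) : ℕ := ⌈2 / s.real 2 0 0⌉₊

theorem isGenerator_incrementProg : IsGenerator incrementProg := ⟨by decide, by decide⟩

theorem isGenerator_drawsProg : IsGenerator drawsProg := ⟨by decide, by decide⟩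

/-- The counter starts at zero and is incremented before each trial, so trial `t` sees the digits of
`t + 1`. -/
theorem exists_digits {N M : ℕ} (f : ℕ → ℕ) (hf : ∀ j, f j < N) :
    ∃ t < N ^ M, ∀ j < M, (t + 1) / N ^ j % N = f j := by
  have hN : 0 < N := (Nat.zero_le _).trans_lt (hf 0)
  obtain ⟨u, hu⟩ : ∃ u : Fin (N ^ M), ∀ j < M, (u : ℕ) / N ^ j % N = f j := by
    refine ⟨finFunctionFinEquiv fun j : Fin M => ⟨f j, hf j⟩, fun j hj => ?_⟩
    have := congrArg (fun g : Fin M → Fin N => (g ⟨j, hj⟩ : ℕ))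
      (finFunctionFinEquiv.symm_apply_apply fun j : Fin M => (⟨f j, hf j⟩ : Fin N))
    simpa [finFunctionFinEquiv] using this
  rcases Nat.eq_zero_or_pos (u : ℕ) with h0 | hpos
  -- The list of zeros occurs in the last trial, when the counter wraps around.
  · refine ⟨N ^ M - 1, Nat.sub_lt (Nat.pow_pos hN) one_pos, fun j hj => ?_⟩
    rw [Nat.sub_add_cancel (Nat.one_le_pow _ _ hN), ← hu j hj, h0, Nat.zero_div, Nat.zero_mod,
      Nat.pow_div hj.le hN]
    exact Nat.mod_eq_zero_of_dvd (dvd_pow_self N (by omega))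
  · refine ⟨u - 1, (Nat.sub_le _ _).trans_lt u.2, fun j hj => ?_⟩
    rw [Nat.sub_add_cancel hpos, hu j hj]

theorem exhaustiveProg_spec (s : State) (hs : s.IsInitial) (hN : 0 < s.nat 0 0 0)
    (hε : 0 < s.real 2 0 0) :
    HaltsIn ω exhaustiveProg s
      ((s.nat 0 0 0 ^ (s.nat 2 0 0 * s.size) + 1) * ((s.nat 2 0 0 + 1) * ((s.nat 1 0 0 + 1) *
        ((s.size + 1) * ((s.nat 0 0 0 + 1) * 2000)))))
      (fun s' => ∀ f : ℕ → ℕ, (∀ j, f j < s.nat 0 0 0) → s.costOf (s'.real 4) ≤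
        s.costOf (sampleMeans s.size (s.real 0) f)) := by
  set N := s.nat 0 0 0 with hN'
  set D := s.nat 1 0 0 with hD'
  set K := s.nat 2 0 0 with hK'
  set S := s.size with hS'
  refine (HaltsIn.seq (T' := ((N + 1) * ((K + 1) * ((D + 1) * 300)) + 10) + (N ^ (K * S) + 1) *
    (((K * S + 1) * 120) + 15 + (K + 1) * ((D + 1) * ((S + 1) * ((N + 1) * 800)))))
    (sizeProg_spec s (hs.nat 4 le_rfl 0 0) (hs.nat 5 (by decide) 0 0) hε)
    fun s₁ hf₁ h₁ => HaltsIn.seq ((initProg_spec s₁ ?_).mono_time ?_) fun s₂ hf₂ h₂ => ?_).mono_time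
      ?_
  · rw [hf₁.real 4 (by decide), hf₁.real 5 (by decide)]
    funext i j
    rw [hs.real 4 le_rfl, hs.real 5 (by decide)]
  · rw [hf₁.nat 0 (by decide), hf₁.nat 1 (by decide), hf₁.nat 2 (by decide)]
  · have e0 : s₂.nat 0 0 0 = N := by rw [hf₂.nat 0 (by decide), hf₁.nat 0 (by decide)]
    have e1 : s₂.nat 1 0 0 = D := by rw [hf₂.nat 1 (by decide), hf₁.nat 1 (by decide)]
    have e2 : s₂.nat 2 0 0 = K := by rw [hf₂.nat 2 (by decide), hf₁.nat 2 (by decide)]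
    have e3 : s₂.nat 3 = s.nat 3 := by rw [hf₂.nat 3 (by decide), hf₁.nat 3 (by decide)]
    have e4 : s₂.nat 4 0 0 = S := by rw [hf₂.nat 4 (by decide), h₁.1]
    have e5 : s₂.nat 5 0 0 = K * S := by rw [hf₂.nat 5 (by decide), h₁.2]
    have e6 : s₂.nat 6 0 0 = 0 := by
      rw [hf₂.nat 6 (by decide), hf₁.nat 6 (by decide), hs.nat 6 (by decide)]
    have e7 : ∀ j, s₂.nat 7 j 0 = 0 := fun j => by
      rw [hf₂.nat 7 (by decide), hf₁.nat 7 (by decide), hs.nat 7 (by decide)]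
    have r0 : s₂.real 0 = s.real 0 := by rw [hf₂.real 0 (by decide), hf₁.real 0 (by decide)]
    have r1 : s₂.real 1 = s.real 1 := by rw [hf₂.real 1 (by decide), hf₁.real 1 (by decide)]
    have ec : s₂.costOf = s.costOf := by
      funext C
      rw [State.costOf, State.costOf, e0, e1, e2, e3, r0, r1]
    have ec' : s₁.costOf = s₂.costOf := by
      funext C
      rw [State.costOf, State.costOf, hf₂.nat 0 (by decide), hf₂.nat 1 (by decide),
        hf₂.nat 2 (by decide), hf₂.nat 3 (by decide), hf₂.real 0 (by decide),
        hf₂.real 1 (by decide)]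
    have hB : ∀ s', Frame (searchProg incrementProg (.pow (.ofNat (.var 0)) (.var 5))) s₂ s' →
        (RExpr.pow (.ofNat (.var 0)) (.var 5)).eval s' = ((N ^ (K * S) : ℕ) : ℝ) := by
      intro s' hf
      have en := isGenerator_incrementProg.search_nat_eq hf
      simp [en 0 (by decide), en 5 (by decide), e0, e5]
    refine (searchProg_spec (ω := ω) isGenerator_incrementProg s₂ hB
      (fun t s' => ∀ j < K * S, s'.nat 7 j 0 = t / N ^ j % N)
      (fun t j => (t + 1) / N ^ j % N) (Tg := (K * S + 1) * 120) e6 ?_ ?_ ?_ ?_).mono ?_ ?_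
    · simp [e7]
    · rw [h₂, ec', hf₂.real 4 (by decide)]
    · intro t s s' hf hG j hj
      rw [hf.nat 7 (by decide), hG j hj]
    · intro t s' hf hG
      have en := isGenerator_incrementProg.search_nat_eq hf
      have i0 : s'.nat 0 0 0 = N := by rw [en 0 (by decide), e0]
      have i5 : s'.nat 5 0 0 = K * S := by rw [en 5 (by decide), e5]
      refine (incrementProg_spec s' (t := t) (by rwa [i0]) (by rwa [i0, i5])).mono
        (by rw [i5]) fun s'' hf'' h => ?_
      rw [i0, i5] at h
      refine ⟨h, ?_⟩
      rwa [e2, e4]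
    · rw [e0, e1, e2, e4, Nat.ceil_natCast]
      simp
    · intro s' _ h f hf
      rw [Nat.ceil_natCast, ec, e4, r0] at h
      obtain ⟨t, ht, hft⟩ := exists_digits (M := K * S) f hf
      refine (h t ht).trans_eq (totalCost_congr fun k hk d _ => ?_)
      exact sampleMeans_congr hft hk d
  · set P := N ^ (K * S) + 1
    have hP : 1 ≤ P := by omega
    have e : (K + 1) * ((D + 1) * ((S + 1) * ((N + 1) * 2000))) =
      2000 * ((K + 1) * (D + 1) * (S + 1) * (N + 1)) := by ring
    have e' : (K + 1) * ((D + 1) * ((S + 1) * ((N + 1) * 800))) =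
      800 * ((K + 1) * (D + 1) * (S + 1) * (N + 1)) := by ring
    have hV1 : S + 1 ≤ (K + 1) * (D + 1) * (S + 1) * (N + 1) := by
      nlinarith [Nat.zero_le (K * D), Nat.zero_le (K * D * S), Nat.zero_le (K * D * S * N),
        Nat.zero_le (K * S * N), Nat.zero_le (K * D * N), Nat.zero_le (D * S * N),
        Nat.zero_le (D * S), Nat.zero_le (K * S), Nat.zero_le (D * N), Nat.zero_le (K * N),
        Nat.zero_le (S * N)]
    have hV2 : K * S + 1 ≤ (K + 1) * (D + 1) * (S + 1) * (N + 1) := by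
      nlinarith [Nat.zero_le (K * D), Nat.zero_le (K * D * S), Nat.zero_le (K * D * S * N),
        Nat.zero_le (K * S * N), Nat.zero_le (K * D * N), Nat.zero_le (D * S * N),
        Nat.zero_le (D * S), Nat.zero_le (K * S), Nat.zero_le (D * N), Nat.zero_le (K * N),
        Nat.zero_le (S * N)]
    have hV3 : (N + 1) * ((K + 1) * ((D + 1) * 300)) ≤
        300 * ((K + 1) * (D + 1) * (S + 1) * (N + 1)) := by
      calc _ = 300 * ((K + 1) * (D + 1) * 1 * (N + 1)) := by ring
        _ ≤ _ := by gcongr; omega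
    rw [e, e']
    set V := (K + 1) * (D + 1) * (S + 1) * (N + 1)
    nlinarith [Nat.mul_le_mul hP hV1, Nat.mul_le_mul_left P hV2, Nat.mul_le_mul_left P hV1]

theorem randomProg_spec (s : State) (hs : s.IsInitial) (hε : 0 < s.real 2 0 0) :
    HaltsIn ω randomProg s
      ((⌈(2 / s.real 3 0 0 ^ s.size) ^ s.nat 2 0 0⌉₊ + 1) * ((s.nat 2 0 0 + 1) *
        ((s.nat 1 0 0 + 1) * ((s.size + 1) * ((s.nat 0 0 0 + 1) * 2000)))))
      (fun s' => ∀ t < ⌈(2 / s.real 3 0 0 ^ s.size) ^ s.nat 2 0 0⌉₊, s.costOf (s'.real 4) ≤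
        s.costOf (sampleMeans s.size (s.real 0) fun j =>
          pick (s.nat 0 0 0) (fun n => s.real 1 n 0) (ω (t * (s.nat 2 0 0 * s.size) + j)))) := by
  set N := s.nat 0 0 0 with hN'
  set D := s.nat 1 0 0 with hD'
  set K := s.nat 2 0 0 with hK'
  set S := s.size with hS'
  set β : ℝ := (2 / s.real 3 0 0 ^ S) ^ K with hβ
  refine (HaltsIn.seq (T' := (N + 1) * 50 + (((N + 1) * ((K + 1) * ((D + 1) * 300)) + 10) +
    (⌈β⌉₊ + 1) * (((K * S + 1) * ((N + 1) * 150)) + 20 +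
      (K + 1) * ((D + 1) * ((S + 1) * ((N + 1) * 800))))))
    (sizeProg_spec s (hs.nat 4 le_rfl 0 0) (hs.nat 5 (by decide) 0 0) hε)
    fun s₀ hf₀ h₀ => HaltsIn.seq ((weightProg_spec s₀ ?_).mono_time ?_) fun s₁ hf₁ h₁ =>
      HaltsIn.seq ((initProg_spec s₁ ?_).mono_time ?_) fun s₂ hf₂ h₂ => ?_).mono_time ?_
  · rw [hf₀.real 11 (by decide), hs.real 11 (by decide)]
  · rw [hf₀.nat 0 (by decide)]
  · rw [hf₁.real 4 (by decide), hf₁.real 5 (by decide), hf₀.real 4 (by decide),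
      hf₀.real 5 (by decide)]
    funext i j
    rw [hs.real 4 le_rfl, hs.real 5 (by decide)]
  · rw [hf₁.nat 0 (by decide), hf₁.nat 1 (by decide), hf₁.nat 2 (by decide),
      hf₀.nat 0 (by decide), hf₀.nat 1 (by decide), hf₀.nat 2 (by decide)]
  · have en : ∀ a < 4, s₂.nat a = s.nat a := by
      intro a ha
      interval_cases a <;>
        rw [hf₂.nat _ (by decide), hf₁.nat _ (by decide), hf₀.nat _ (by decide)]
    have er : ∀ a < 4, s₂.real a = s.real a := by
      intro a ha
      interval_cases a <;>
        rw [hf₂.real _ (by decide), hf₁.real _ (by decide), hf₀.real _ (by decide)]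
    have e0 : s₂.nat 0 0 0 = N := by rw [en 0 (by decide)]
    have e1 : s₂.nat 1 0 0 = D := by rw [en 1 (by decide)]
    have e2 : s₂.nat 2 0 0 = K := by rw [en 2 (by decide)]
    have e4 : s₂.nat 4 0 0 = S := by rw [hf₂.nat 4 (by decide), hf₁.nat 4 (by decide), h₀.1]
    have e5 : s₂.nat 5 0 0 = K * S := by rw [hf₂.nat 5 (by decide), hf₁.nat 5 (by decide), h₀.2]
    have e6 : s₂.nat 6 0 0 = 0 := by
      rw [hf₂.nat 6 (by decide), hf₁.nat 6 (by decide), hf₀.nat 6 (by decide),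
        hs.nat 6 (by decide)]
    have ed : s₂.drawn = 0 := by
      rw [hf₂.drawn, hf₁.drawn, hf₀.drawn, hs.drawn]
      all_goals simp [sizeProg, weightProg, initProg, costProg, pointProg, sqDistProg,
        Program.forLoop, Program.Deterministic]
    have r11 : s₂.real 11 0 0 = ∑ n ∈ Finset.range N, s.real 1 n 0 := by
      rw [hf₂.real 11 (by decide), h₁, hf₀.nat 0 (by decide), hf₀.real 1 (by decide)]
    have ec : s₂.costOf = s.costOf := by
      funext C
      rw [State.costOf, State.costOf, en 0 (by decide), en 1 (by decide), en 2 (by decide),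
        en 3 (by decide), er 0 (by decide), er 1 (by decide)]
    have ec' : s₁.costOf = s₂.costOf := by
      funext C
      rw [State.costOf, State.costOf, hf₂.nat 0 (by decide), hf₂.nat 1 (by decide),
        hf₂.nat 2 (by decide), hf₂.nat 3 (by decide), hf₂.real 0 (by decide),
        hf₂.real 1 (by decide)]
    have hB : ∀ s', Frame (searchProg drawsProg
        (.pow (.div (.const 2) (.pow (.var 3) (.var 4))) (.var 2))) s₂ s' →
        (RExpr.pow (.div (.const 2) (.pow (.var 3) (.var 4))) (.var 2)).eval s' = β := by
      intro s' hf
      have hn := isGenerator_drawsProg.search_nat_eq hf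
      have hr := isGenerator_drawsProg.search_real_eq hf (a := 3) (by decide)
      simp [hn 2 (by decide), hn 4 (by decide), hr, e2, e4, er 3 (by decide), hβ]
    refine (searchProg_spec (ω := ω) isGenerator_drawsProg s₂ hB
      -- Every trial consumes exactly `K * S` random numbers, and evaluating the candidate consumes
      -- none.
      (fun t s' => s'.drawn = t * (K * S))
      (fun t j => pick N (fun n => s.real 1 n 0) (ω (t * (K * S) + j)))
      (Tg := (K * S + 1) * ((N + 1) * 150)) e6 ?_ ?_ ?_ ?_).mono ?_ ?_
    · simp [ed]
    · rw [h₂, ec', hf₂.real 4 (by decide)]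
    · intro t s s' hf hG
      rw [hf.drawn, hG]
      simp [trialProg, meansProg, meanProg, coordProg, costProg, pointProg, sqDistProg, updateProg,
        copyProg, Program.forLoop, Program.Deterministic]
    · intro t s' hf hG
      have hn := isGenerator_drawsProg.search_nat_eq hf
      have i0 : s'.nat 0 0 0 = N := by rw [hn 0 (by decide), e0]
      have i5 : s'.nat 5 0 0 = K * S := by rw [hn 5 (by decide), e5]
      have i1 : s'.real 1 = s.real 1 := by
        rw [isGenerator_drawsProg.search_real_eq hf (by decide), er 1 (by decide)]
      have i11 : s'.real 11 = s₂.real 11 :=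
        isGenerator_drawsProg.search_real_eq hf (by decide)
      refine (drawsProg_spec s' (by rw [i11, r11, i0, i1])).mono
        (by rw [i0, i5]) fun s'' hf'' h => ?_
      rw [i0, i5, i1, hG] at h
      refine ⟨by rw [h.1]; ring, ?_⟩
      rw [e2, e4]
      exact h.2
    · rw [e0, e1, e2, e4]
      simp
    · intro s' _ h
      rwa [ec, e4, er 0 (by decide)] at h
  · set P := ⌈β⌉₊ + 1
    have hP : 1 ≤ P := by omega
    have e : (K + 1) * ((D + 1) * ((S + 1) * ((N + 1) * 2000))) =
      2000 * ((K + 1) * (D + 1) * (S + 1) * (N + 1)) := by ring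
    have e' : (K + 1) * ((D + 1) * ((S + 1) * ((N + 1) * 800))) =
      800 * ((K + 1) * (D + 1) * (S + 1) * (N + 1)) := by ring
    have hV1 : S + 1 ≤ (K + 1) * (D + 1) * (S + 1) * (N + 1) := by
      nlinarith [Nat.zero_le (K * D), Nat.zero_le (K * D * S), Nat.zero_le (K * D * S * N),
        Nat.zero_le (K * S * N), Nat.zero_le (K * D * N), Nat.zero_le (D * S * N),
        Nat.zero_le (D * S), Nat.zero_le (K * S), Nat.zero_le (D * N), Nat.zero_le (K * N),
        Nat.zero_le (S * N)]
    have hV2 : (K * S + 1) * ((N + 1) * 150) ≤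
        150 * ((K + 1) * (D + 1) * (S + 1) * (N + 1)) := by
      calc _ = 150 * ((K * S + 1) * (N + 1)) := by ring
        _ ≤ _ := by
          gcongr
          nlinarith [Nat.zero_le (K * D * S), Nat.zero_le (K * D), Nat.zero_le (D * S)]
    have hV3 : (N + 1) * ((K + 1) * ((D + 1) * 300)) ≤
        300 * ((K + 1) * (D + 1) * (S + 1) * (N + 1)) := by
      calc _ = 300 * ((K + 1) * (D + 1) * 1 * (N + 1)) := by ring
        _ ≤ _ := by gcongr; omega
    have hV4 : (N + 1) * 50 ≤ 50 * ((K + 1) * (D + 1) * (S + 1) * (N + 1)) := by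
      calc _ = 50 * (1 * 1 * 1 * (N + 1)) := by ring
        _ ≤ _ := by gcongr <;> omega
    rw [e, e']
    set V := (K + 1) * (D + 1) * (S + 1) * (N + 1)
    nlinarith [Nat.mul_le_mul hP hV1, Nat.mul_le_mul_left P hV2, Nat.mul_le_mul_left P hV1]

end Specifications

/-! ### Optimality of the induced memberships -/

section Memberships

variable {ι : Type*} [Fintype ι] {m : ℕ}

theorem root_pow {y : ℝ} (hy : 0 < y) {q : ℕ} (hq : q ≠ 0) : root y q ^ q = y := by
  rw [root, if_pos hy.le]
  exact Real.rpow_inv_natCast_pow hy.le hq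

theorem root_pos {y : ℝ} (hy : 0 < y) (q : ℕ) : 0 < root y q := by
  rw [root, if_pos hy.le]
  exact Real.rpow_pos_of_pos hy _

/-- Roots of natural order thus suffice to compute the real power in the induced memberships from
squared distances. -/
theorem inv_root_sq {y : ℝ} (hy : 0 < y) (hm : 2 ≤ m) :
    1 / root (y ^ 2) (m - 1) = y ^ (-(2 / ((m : ℝ) - 1))) := by
  rw [root, if_pos (sq_nonneg y), Real.rpow_neg hy.le, one_div, ← Real.rpow_natCast,
    ← Real.rpow_mul hy.le, Nat.cast_sub (by omega)]
  norm_num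
  rfl

/-- The cost of optimal memberships for the squared distances `a`. -/
theorem sum_pow_mul_eq [Nonempty ι] {a : ι → ℝ} (ha : ∀ k, 0 < a k) (hm : 2 ≤ m) :
    ∑ k, ((1 / root (a k) (m - 1)) / ∑ l, 1 / root (a l) (m - 1)) ^ m * a k =
      1 / (∑ k, 1 / root (a k) (m - 1)) ^ (m - 1) := by
  set S := ∑ l, 1 / root (a l) (m - 1) with hS
  have hS0 : 0 < S := Finset.sum_pos (fun k _ => one_div_pos.2 (root_pos (ha k) _))
    Finset.univ_nonempty
  have hterm : ∀ k, ((1 / root (a k) (m - 1)) / S) ^ m * a k =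
      (1 / root (a k) (m - 1)) * (1 / S ^ m) := by
    intro k
    have hr := root_pos (ha k) (m - 1)
    obtain ⟨q, rfl⟩ : ∃ q, m = q + 1 := ⟨m - 1, by omega⟩
    have hp : root (a k) q ^ q = a k := root_pow (ha k) (by omega)
    rw [Nat.add_sub_cancel] at hr ⊢
    rw [div_pow, div_pow, one_pow, pow_succ (root (a k) q), hp]
    have := ha k
    field_simp
  rw [Finset.sum_congr rfl fun k _ => hterm k, ← Finset.sum_mul, ← hS]
  obtain ⟨q, rfl⟩ : ∃ q, m = q + 1 := ⟨m - 1, by omega⟩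
  rw [Nat.add_sub_cancel, pow_succ]
  field_simp

/-- Jensen's inequality for `t ↦ t ^ m`, with the optimal memberships `p_k` as weights and the
points `r_k / p_k`, whose weighted mean is `1`. Each term `p_k (r_k / p_k)^m` equals `r_k^m a_k
S^(m-1)`, because `p_k` is the inverse `(m-1)`-th root of `a_k` divided by `S`. -/
theorem le_sum_pow_mul {a r : ι → ℝ} (ha : ∀ k, 0 < a k) (hm : 2 ≤ m) (hr : ∀ k, 0 ≤ r k)
    (hr1 : ∑ k, r k = 1) :
    1 / (∑ k, 1 / root (a k) (m - 1)) ^ (m - 1) ≤ ∑ k, r k ^ m * a k := by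
  have hne : Nonempty ι := by
    by_contra h
    rw [not_nonempty_iff] at h
    simp at hr1
  set S := ∑ l, 1 / root (a l) (m - 1) with hS
  have hS0 : 0 < S := Finset.sum_pos (fun k _ => one_div_pos.2 (root_pos (ha k) _))
    Finset.univ_nonempty
  have h := Real.pow_arith_mean_le_arith_mean_pow Finset.univ
    (fun k => (1 / root (a k) (m - 1)) / S) (fun k => r k / ((1 / root (a k) (m - 1)) / S))
    (fun k _ => by have := root_pos (ha k) (m - 1); positivity)
    (by rw [← Finset.sum_div, ← hS, div_self hS0.ne'])
    (fun k _ => by have := root_pos (ha k) (m - 1); have := hr k; positivity) m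
  have h1 : ∑ k, (1 / root (a k) (m - 1)) / S * (r k / ((1 / root (a k) (m - 1)) / S)) = 1 := by
    rw [← hr1]
    refine Finset.sum_congr rfl fun k _ => ?_
    have := root_pos (ha k) (m - 1)
    field_simp
  have h2 : ∀ k, (1 / root (a k) (m - 1)) / S * (r k / ((1 / root (a k) (m - 1)) / S)) ^ m =
      r k ^ m * a k * S ^ (m - 1) := by
    intro k
    have hr := root_pos (ha k) (m - 1)
    obtain ⟨q, rfl⟩ : ∃ q, m = q + 1 := ⟨m - 1, by omega⟩
    have hp : root (a k) q ^ q = a k := root_pow (ha k) (by omega)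
    rw [Nat.add_sub_cancel] at hr ⊢
    rw [show r k ^ (q + 1) * a k * S ^ q = r k ^ (q + 1) * root (a k) q ^ q * S ^ q by rw [hp]]
    field_simp
    ring
  rw [h1, one_pow, Finset.sum_congr rfl fun k _ => h2 k, ← Finset.sum_mul] at h
  rwa [div_le_iff₀ (pow_pos hS0 _)]

end Memberships

/-! ### The cost of means in terms of squared distances -/

section Instance

variable {N D K L m : ℕ} {x : Fin N → EuclideanSpace ℝ (Fin D)} {w : Fin N → ℝ}

theorem sqDist_eq {X C : ℕ → ℕ → ℝ} {n k : ℕ} {y z : EuclideanSpace ℝ (Fin D)}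
    (hy : ∀ d : Fin D, X n d = y d) (hz : ∀ d : Fin D, C k d = z d) :
    sqDist D X C n k = ‖y - z‖ ^ 2 := by
  rw [EuclideanSpace.norm_sq_eq, sqDist, Finset.sum_range]
  refine Finset.sum_congr rfl fun d _ => ?_
  rw [hy, hz, Real.norm_eq_abs, sq_abs]
  rfl

/-- The cost of a point, if the arrays `X` and `C` hold the points `x` and the means `μ`. -/
theorem pointCost_eq {X C : ℕ → ℕ → ℝ} {μ : Fin K → EuclideanSpace ℝ (Fin D)}
    (hX : ∀ (n : Fin N) (d : Fin D), X n d = x n d) (hC : ∀ (k : Fin K) (d : Fin D), C k d = μ k d)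
    (n : Fin N) [Decidable (∀ k, 0 < ‖x n - μ k‖ ^ 2)] :
    pointCost D K m X C n = if ∀ k, 0 < ‖x n - μ k‖ ^ 2 then
      1 / (∑ k, 1 / root (‖x n - μ k‖ ^ 2) (m - 1)) ^ (m - 1) else 0 := by
  have hd : ∀ k : Fin K, sqDist D X C n k = ‖x n - μ k‖ ^ 2 := fun k => sqDist_eq (hX n) (hC k)
  have h1 : (∀ k < K, 0 < sqDist D X C n k) ↔ ∀ k, 0 < ‖x n - μ k‖ ^ 2 :=
    ⟨fun h k => hd k ▸ h k k.2, fun h k hk => (hd ⟨k, hk⟩).symm ▸ h ⟨k, hk⟩⟩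
  rw [pointCost, Finset.sum_range]
  simp only [hd, h1]

theorem norm_sub_sq_pos_iff {y z : EuclideanSpace ℝ (Fin D)} : 0 < ‖y - z‖ ^ 2 ↔ y ≠ z := by
  rw [sq_pos_iff, norm_ne_zero_iff, sub_ne_zero]

/-- Away from the means this is the closed form `sum_pow_mul_eq`. A point equal to some mean has
membership zero in every mean at positive distance, so it contributes zero on both sides. -/
theorem costOfMeans_eq {X C : ℕ → ℕ → ℝ} {W : ℕ → ℝ} {μ : Fin K → EuclideanSpace ℝ (Fin D)}
    (hK : 1 ≤ K) (hm : 2 ≤ m) (hX : ∀ (n : Fin N) (d : Fin D), X n d = x n d)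
    (hW : ∀ n : Fin N, W n = w n) (hC : ∀ (k : Fin K) (d : Fin D), C k d = μ k d) :
    costOfMeans m x w μ = totalCost N D K m X W C := by
  classical
  rw [costOfMeans, cost, totalCost, Finset.sum_range]
  refine Finset.sum_congr rfl fun n _ => ?_
  rw [pointCost_eq hX hC, hW]
  have : Nonempty (Fin K) := ⟨⟨0, hK⟩⟩
  split_ifs with h
  · rw [← sum_pow_mul_eq h hm, Finset.mul_sum]
    refine Finset.sum_congr rfl fun k _ => ?_
    have h' : ¬ ∃ l, x n = μ l := fun ⟨l, hl⟩ => norm_sub_sq_pos_iff.1 (h l) hl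
    have hr : ∀ l, 1 / root (‖x n - μ l‖ ^ 2) (m - 1) = ‖x n - μ l‖ ^ (-(2 / ((m : ℝ) - 1))) :=
      fun l => inv_root_sq (norm_pos_iff.2 (sub_ne_zero.2 (norm_sub_sq_pos_iff.1 (h l)))) hm
    rw [inducedMemberships, if_neg h']
    simp only [hr]
    ring
  · push Not at h
    obtain ⟨l, hl⟩ := h
    have h' : ∃ l, x n = μ l := ⟨l, by
      by_contra hne
      exact absurd (norm_sub_sq_pos_iff.2 hne) (not_lt.2 hl)⟩
    rw [mul_zero]
    refine Finset.sum_eq_zero fun k _ => ?_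
    rw [inducedMemberships, if_pos h']
    split_ifs with hk
    · simp [hk]
    · simp [show m ≠ 0 by omega]

/-- Means compete with every solution that uses only some of them. -/
theorem costOfMeans_le_cost (hm : 2 ≤ m) (hLK : L ≤ K) (hw : ∀ n, 0 ≤ w n)
    (μ : Fin K → EuclideanSpace ℝ (Fin D)) {r : Fin N → Fin L → ℝ} (hr : IsMembership r) :
    costOfMeans m x w μ ≤ cost m x w (fun l => μ (Fin.castLE hLK l)) r := by
  classical
  rcases Nat.eq_zero_or_pos K with rfl | hK
  · obtain rfl : L = 0 := by omega
    simp [costOfMeans, cost]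
  obtain ⟨X, hX⟩ : ∃ X : ℕ → ℕ → ℝ, ∀ (n : Fin N) (d : Fin D), X n d = x n d :=
    ⟨fun n d => if h : n < N ∧ d < D then x ⟨n, h.1⟩ ⟨d, h.2⟩ else 0, fun n d => by simp⟩
  obtain ⟨W, hW⟩ : ∃ W : ℕ → ℝ, ∀ n : Fin N, W n = w n :=
    ⟨fun n => if h : n < N then w ⟨n, h⟩ else 0, fun n => by simp⟩
  obtain ⟨C, hC⟩ : ∃ C : ℕ → ℕ → ℝ, ∀ (k : Fin K) (d : Fin D), C k d = μ k d :=
    ⟨fun k d => if h : k < K ∧ d < D then μ ⟨k, h.1⟩ ⟨d, h.2⟩ else 0, fun n d => by simp⟩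
  rw [costOfMeans_eq hK hm hX hW hC, totalCost, cost, Finset.sum_range]
  refine Finset.sum_le_sum fun n _ => ?_
  rw [pointCost_eq hX hC, hW]
  have e : ∑ l, r n l ^ m * w n * ‖x n - μ (Fin.castLE hLK l)‖ ^ 2 =
      w n * ∑ l, r n l ^ m * ‖x n - μ (Fin.castLE hLK l)‖ ^ 2 := by
    rw [Finset.mul_sum]
    exact Finset.sum_congr rfl fun l _ => by ring
  rw [e]
  refine mul_le_mul_of_nonneg_left ?_ (hw n)
  have hinj := Fin.castLE_injective hLK
  split_ifs with h
  -- The means outside the first `L` receive membership zero, which turns `r n` into a competitor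
  -- for the optimal memberships of all `K` means.
  · set r' : Fin K → ℝ := Function.extend (Fin.castLE hLK) (r n) 0 with hr'
    have hr0 : ∀ k ∉ Set.range (Fin.castLE hLK), r' k = 0 := fun k hk => by
      rw [hr', Function.extend_apply' _ _ _ hk]
      rfl
    have hrl : ∀ l, r' (Fin.castLE hLK l) = r n l := fun l => hinj.extend_apply _ _ _
    refine (le_sum_pow_mul (r := r') h hm (fun k => ?_) ?_).trans_eq ?_
    · by_cases hk : k ∈ Set.range (Fin.castLE hLK)
      · obtain ⟨l, rfl⟩ := hk
        rw [hrl]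
        exact hr.nonneg n l
      · rw [hr0 k hk]
    · rw [← hr.sum_eq_one n]
      exact (Fintype.sum_of_injective _ hinj _ _ hr0 fun l => (hrl l).symm).symm
    · refine (Fintype.sum_of_injective _ hinj _ _ (fun k hk => ?_) fun l => ?_).symm
      · rw [hr0 k hk, zero_pow (by omega), zero_mul]
      · rw [hrl]
  · exact Finset.sum_nonneg fun l _ =>
      mul_nonneg (pow_nonneg (hr.nonneg n l) m) (sq_nonneg _)

/-! ### Sampling from a weighted point set -/

section Sampling

variable {ι E : Type*} [Fintype ι] [NormedAddCommGroup E] [InnerProductSpace ℝ E]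

/-- The parallel axis identity: expanding around `μ`, the cross term vanishes. The centroid
condition is stated without division, so that it also covers total mass zero. -/
theorem sum_mul_norm_sub_sq {a : ι → ℝ} {y : ι → E} {μ : E} (hμ : ∑ n, a n • (y n - μ) = 0)
    (c : E) : ∑ n, a n * ‖y n - c‖ ^ 2 = ∑ n, a n * ‖y n - μ‖ ^ 2 + (∑ n, a n) * ‖c - μ‖ ^ 2 := by
  have h : ∀ n, a n * ‖y n - c‖ ^ 2 =
      a n * ‖y n - μ‖ ^ 2 - 2 * inner ℝ (a n • (y n - μ)) (c - μ) + a n * ‖c - μ‖ ^ 2 := by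
    intro n
    rw [show y n - c = (y n - μ) - (c - μ) by abel, norm_sub_sq_real, real_inner_smul_left]
    ring
  rw [Finset.sum_congr rfl fun n _ => h n, Finset.sum_add_distrib, Finset.sum_sub_distrib,
    ← Finset.mul_sum, ← sum_inner, hμ, inner_zero_left, mul_zero, sub_zero, Finset.sum_mul]

theorem sum_fun_succ {R : Type*} [AddCommMonoid R] {s : ℕ} (F : (Fin (s + 1) → ι) → R) :
    ∑ f, F f = ∑ n : ι, ∑ f : Fin s → ι, F (Fin.cons n f) := by
  rw [← Fintype.sum_prod_type', ← (Fin.consEquiv fun _ : Fin (s + 1) => ι).sum_comp]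
  rfl

theorem sum_prod_eq_pow (a : ι → ℝ) (s : ℕ) :
    ∑ f : Fin s → ι, ∏ i, a (f i) = (∑ n, a n) ^ s := by
  classical
  rw [← Fin.prod_const, Finset.prod_univ_sum, Fintype.piFinset_univ]

/-- The second moment of a sum of `s` independent centred vectors is `s` times that of one; in the
induction the new cross term is zero. The masses are not normalised, and the extra factor `∑ a`
avoids both division and the exponent `s - 1`. -/
theorem sum_prod_mul_norm_sum_sq {a : ι → ℝ} {y : ι → E} (h : ∑ n, a n • y n = 0) (s : ℕ) :
    (∑ n, a n) * ∑ f : Fin s → ι, (∏ i, a (f i)) * ‖∑ i, y (f i)‖ ^ 2 =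
      s * (∑ n, a n) ^ s * ∑ n, a n * ‖y n‖ ^ 2 := by
  induction s with
  | zero => simp
  | succ s ih =>
    have hterm : ∀ (n : ι) (f : Fin s → ι),
        (∏ i, a ((Fin.cons n f : Fin (s + 1) → ι) i)) *
          ‖∑ i, y ((Fin.cons n f : Fin (s + 1) → ι) i)‖ ^ 2 =
        (∏ i, a (f i)) * (a n * ‖y n‖ ^ 2) +
          2 * inner ℝ (a n • y n) ((∏ i, a (f i)) • ∑ i, y (f i)) +
          a n * ((∏ i, a (f i)) * ‖∑ i, y (f i)‖ ^ 2) := by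
      intro n f
      rw [Fin.prod_univ_succ, Fin.sum_univ_succ]
      simp only [Fin.cons_zero, Fin.cons_succ]
      rw [norm_add_sq_real, real_inner_smul_left, real_inner_smul_right]
      ring
    have hcross : ∑ n, ∑ f : Fin s → ι,
        2 * inner ℝ (a n • y n) ((∏ i, a (f i)) • ∑ i, y (f i)) = 0 := by
      simp only [← Finset.mul_sum, ← inner_sum]
      rw [← sum_inner, h, inner_zero_left, mul_zero]
    rw [sum_fun_succ]
    simp only [hterm, Finset.sum_add_distrib]
    rw [hcross]
    simp only [← Finset.mul_sum, ← Finset.sum_mul, sum_prod_eq_pow]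
    rw [add_zero, mul_add, mul_left_comm _ (∑ n, a n), ih]
    push_cast
    ring

/-- The mean of the samples is so good that it can replace the mean `μ` of the points. -/
def IsGoodSample {s : ℕ} (a : ι → ℝ) (x : ι → E) (μ : E) (ε : ℝ) (f : Fin s → ι) : Prop :=
  (∑ n, a n) * ‖(s : ℝ)⁻¹ • (∑ i, x (f i)) - μ‖ ^ 2 ≤ ε * ∑ n, a n * ‖x n - μ‖ ^ 2

-- Markov's inequality for the squared deviation of the sample mean, whose average is `V / s` in the
-- units of `IsGoodSample`. As `s * ε ≥ 2`, the threshold `ε * V` is at least twice this average.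
open Classical in
theorem half_le_sum_isGoodSample {a : ι → ℝ} {x : ι → E} {μ : E} {ε : ℝ} {s : ℕ}
    (ha : ∀ n, 0 ≤ a n) (hμ : ∑ n, a n • (x n - μ) = 0) (hε : 0 < ε) (hs : 2 ≤ s * ε) :
    (∑ n, a n) ^ s / 2 ≤
      ∑ f : Fin s → ι with IsGoodSample a x μ ε f, ∏ i, a (f i) := by
  set R := ∑ n, a n with hR
  set V := ∑ n, a n * ‖x n - μ‖ ^ 2 with hV
  have hs0 : (0 : ℝ) < s := by
    by_contra h
    nlinarith
  have hR0 : 0 ≤ R := Finset.sum_nonneg fun n _ => ha n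
  have hV0 : 0 ≤ V := Finset.sum_nonneg fun n _ => mul_nonneg (ha n) (sq_nonneg _)
  have hp0 : ∀ f : Fin s → ι, 0 ≤ ∏ i, a (f i) := fun f => Finset.prod_nonneg fun i _ => ha _
  have hnorm : ∀ f : Fin s → ι, ‖(s : ℝ)⁻¹ • (∑ i, x (f i)) - μ‖ ^ 2 =
      (s : ℝ)⁻¹ ^ 2 * ‖∑ i, (x (f i) - μ)‖ ^ 2 := by
    intro f
    rw [Finset.sum_sub_distrib, Finset.sum_const, Finset.card_univ, Fintype.card_fin,
      ← mul_pow, ← abs_of_pos (inv_pos.2 hs0), ← Real.norm_eq_abs, ← norm_smul, smul_sub,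
      Real.norm_eq_abs, abs_of_pos (inv_pos.2 hs0), ← Nat.cast_smul_eq_nsmul ℝ, smul_smul,
      inv_mul_cancel₀ hs0.ne', one_smul]
  have htot : ∑ f : Fin s → ι, (∏ i, a (f i)) * (R * ‖(s : ℝ)⁻¹ • (∑ i, x (f i)) - μ‖ ^ 2) =
      R ^ s * V / s := by
    have := sum_prod_mul_norm_sum_sq hμ s
    calc _ = (s : ℝ)⁻¹ ^ 2 * (R * ∑ f : Fin s → ι,
          (∏ i, a (f i)) * ‖∑ i, (x (f i) - μ)‖ ^ 2) := by
          rw [Finset.mul_sum, Finset.mul_sum]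
          refine Finset.sum_congr rfl fun f _ => ?_
          rw [hnorm]
          ring
      _ = _ := by
          rw [this, ← hR, ← hV]
          field_simp
  have hle : R ^ s * V / s ≤ ε * V * (R ^ s / 2) := by
    rw [div_le_iff₀ hs0]
    have : 0 ≤ R ^ s * V := mul_nonneg (pow_nonneg hR0 s) hV0
    nlinarith
  set B := ∑ f : Fin s → ι with ¬ IsGoodSample a x μ ε f, ∏ i, a (f i) with hB
  have hsum : ∑ f : Fin s → ι with IsGoodSample a x μ ε f, ∏ i, a (f i) + B = R ^ s := by
    rw [hB, Finset.sum_filter_add_sum_filter_not, sum_prod_eq_pow]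
  have hBle : B ≤ R ^ s / 2 := by
    rcases hV0.eq_or_lt with hV' | hV'
    -- With `V = 0` the threshold is zero and cannot be cancelled. Instead the average vanishes, so
    -- every bad sample has mass zero.
    · have h0 : ∀ f ∈ (Finset.univ : Finset (Fin s → ι)),
          (∏ i, a (f i)) * (R * ‖(s : ℝ)⁻¹ • (∑ i, x (f i)) - μ‖ ^ 2) = 0 := by
        rw [← Finset.sum_eq_zero_iff_of_nonneg
          fun f _ => mul_nonneg (hp0 f) (mul_nonneg hR0 (sq_nonneg _)), htot, ← hV']
        simp
      have : B = 0 := by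
        refine Finset.sum_eq_zero fun f hf => ?_
        have hb : ¬ IsGoodSample a x μ ε f := (Finset.mem_filter.1 hf).2
        rw [IsGoodSample, ← hV, ← hV', mul_zero, not_le] at hb
        exact (mul_eq_zero.1 (h0 f (Finset.mem_univ f))).resolve_right hb.ne'
      rw [this]
      positivity
    · have h1 : B * (ε * V) ≤ ε * V * (R ^ s / 2) := by
        refine le_trans ?_ (htot.trans_le hle)
        rw [hB, Finset.sum_mul]
        refine (Finset.sum_le_sum fun f hf => ?_).trans (Finset.sum_le_sum_of_subset_of_nonneg
          (Finset.filter_subset _ _) fun f _ _ => mul_nonneg (hp0 f) (mul_nonneg hR0 (sq_nonneg _)))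
        have hb : ¬ IsGoodSample a x μ ε f := (Finset.mem_filter.1 hf).2
        exact mul_le_mul_of_nonneg_left (not_le.1 hb).le (hp0 f)
      rw [mul_comm] at h1
      exact le_of_mul_le_mul_left h1 (mul_pos hε hV')
  linarith

/-- Good samples carry positive mass, hence exist; if the total mass is zero, every sample is good.
-/
theorem exists_isGoodSample [Nonempty ι] {a : ι → ℝ} {x : ι → E} {μ : E} {ε : ℝ} {s : ℕ}
    (ha : ∀ n, 0 ≤ a n) (hμ : ∑ n, a n • (x n - μ) = 0) (hε : 0 < ε) (hs : 2 ≤ s * ε) :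
    ∃ f : Fin s → ι, IsGoodSample a x μ ε f := by
  classical
  rcases (Finset.sum_nonneg fun n _ => ha n : 0 ≤ ∑ n, a n).eq_or_lt with h | h
  · refine ⟨fun _ => Classical.arbitrary ι, ?_⟩
    rw [IsGoodSample, ← h, zero_mul]
    exact mul_nonneg hε.le (Finset.sum_nonneg fun n _ => mul_nonneg (ha n) (sq_nonneg _))
  · have h' := half_le_sum_isGoodSample ha hμ hε hs
    by_contra! hf
    rw [Finset.filter_false_of_mem fun f _ => hf f, Finset.sum_empty] at h'
    have := pow_pos h s
    linarith

end Sampling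

/-- For a cluster of weight zero all coefficients vanish, so the conventional value of its mean does
not matter. -/
theorem sum_smul_sub_inducedMeans (hw : ∀ n, 0 ≤ w n) {r : Fin N → Fin L → ℝ}
    (hr : ∀ n l, 0 ≤ r n l) (l : Fin L) :
    ∑ n, (r n l ^ m * w n) • (x n - inducedMeans m x w r l) = 0 := by
  have ha : ∀ n, 0 ≤ r n l ^ m * w n := fun n => mul_nonneg (pow_nonneg (hr n l) m) (hw n)
  rcases eq_or_ne (clusterWeight m w r l) 0 with h | h
  · rw [clusterWeight, Finset.sum_eq_zero_iff_of_nonneg fun n _ => ha n] at h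
    exact Finset.sum_eq_zero fun n hn => by rw [h n hn, zero_smul]
  · simp only [smul_sub, Finset.sum_sub_distrib]
    rw [← Finset.sum_smul, inducedMeans]
    change _ - clusterWeight m w r l • _ = 0
    rw [smul_smul, mul_inv_cancel₀ h, one_smul, sub_self]

/-- Means of good samples from all clusters give a `(1 + ε)`-approximation. -/
theorem costOfMeans_le_of_isGoodSample {s : ℕ} {ε : ℝ} (hm : 2 ≤ m) (hLK : L ≤ K)
    (hw : ∀ n, 0 ≤ w n) {r : Fin N → Fin L → ℝ} (hr : IsMembership r)
    {μ : Fin K → EuclideanSpace ℝ (Fin D)} {g : Fin K → Fin s → Fin N}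
    (hμ : ∀ k, μ k = (s : ℝ)⁻¹ • ∑ i, x (g k i))
    (hg : ∀ l, IsGoodSample (fun n => r n l ^ m * w n) x (inducedMeans m x w r l) ε
      (g (Fin.castLE hLK l))) :
    costOfMeans m x w μ ≤ (1 + ε) * costOfMemberships m x w r := by
  refine (costOfMeans_le_cost hm hLK hw μ hr).trans ?_
  rw [costOfMemberships, cost, cost, Finset.sum_comm, Finset.sum_comm (γ := Fin N),
    Finset.mul_sum]
  refine Finset.sum_le_sum fun l _ => ?_
  have h := hg l
  rw [IsGoodSample, ← hμ] at h
  rw [sum_mul_norm_sub_sq (sum_smul_sub_inducedMeans hw hr.nonneg l)]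
  linarith

end Instance

open MeasureTheory

/-! ### Random samples -/

instance : IsProbabilityMeasure randomLaw := by
  unfold randomLaw
  infer_instance

/-- Independence in the form needed here: the event is a box over finitely many coordinates.
Injectivity of `e` ensures that each coordinate carries only one condition. -/
theorem randomLaw_cylinder {ι A : Type*} [Fintype ι] [Finite A] {e : ι → ℕ}
    (he : Function.Injective e) {pk : unitInterval → A} (hpk : ∀ a, MeasurableSet (pk ⁻¹' {a}))
    (h : ι → A) :
    randomLaw {ω | ∀ z, pk (ω (e z)) = h z} = ENNReal.ofReal (∏ z, volume.real (pk ⁻¹' {h z})) := by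
  classical
  have hset : {ω : ℕ → unitInterval | ∀ z, pk (ω (e z)) = h z} =
      Set.pi (Finset.univ.map ⟨e, he⟩ : Finset ℕ) fun j => {u | ∀ z, e z = j → pk u = h z} := by
    ext ω
    simp only [Set.mem_ofPred_eq, Set.mem_pi, Finset.coe_map, Finset.coe_univ, Set.image_univ,
      Set.mem_range, Function.Embedding.coeFn_mk]
    constructor
    · rintro hω j - z rfl
      exact hω z
    · exact fun hω z => hω (e z) ⟨z, rfl⟩ z rfl
  have hpt : ∀ z, {u | ∀ z', e z' = e z → pk u = h z'} = pk ⁻¹' {h z} := by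
    intro z
    ext u
    simp only [Set.mem_ofPred_eq, Set.mem_preimage, Set.mem_singleton_iff]
    exact ⟨fun hu => hu z rfl, fun hu z' hz => by rw [he hz, hu]⟩
  rw [hset, randomLaw, Measure.infinitePi_pi]
  · rw [Finset.prod_map, ENNReal.ofReal_prod_of_nonneg fun _ _ => measureReal_nonneg]
    refine Finset.prod_congr rfl fun z _ => ?_
    rw [Function.Embedding.coeFn_mk, hpt, ofReal_measureReal]
  · intro j hj
    obtain ⟨z, -, rfl⟩ := Finset.mem_map.1 hj
    rw [Function.Embedding.coeFn_mk, hpt]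
    exact hpk _

theorem sum_measureReal_preimage {A : Type*} [Fintype A] {pk : unitInterval → A}
    (hpk : ∀ a, MeasurableSet (pk ⁻¹' {a})) : ∑ a, volume.real (pk ⁻¹' {a}) = 1 := by
  rw [← measureReal_biUnion_finset (fun a _ b _ hab => ?_) fun a _ => hpk a]
  · have : ⋃ b ∈ (Finset.univ : Finset A), pk ⁻¹' {b} = Set.univ := by
      ext u
      simp
    rw [this, probReal_univ]
  · exact Disjoint.preimage _ (Set.disjoint_singleton.2 hab)

/-- Trial, mean and position within the sample are the mixed-radix digits of the index of a random
number. -/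
theorem sampleIndex_injective (T K S : ℕ) : Function.Injective
    fun z : Fin T × Fin K × Fin S => (z.1 * (K * S) + (z.2.1 * S + z.2.2) : ℕ) := by
  have h : (fun z : Fin T × Fin K × Fin S => (z.1 * (K * S) + (z.2.1 * S + z.2.2) : ℕ)) =
      fun z => ((finProdFinEquiv (z.1, finProdFinEquiv z.2) : Fin (T * (K * S))) : ℕ) := by
    funext z
    simp only [finProdFinEquiv_apply_val]
    ring
  rw [h]
  intro z z' hz
  have h1 : (z.1, finProdFinEquiv z.2) = (z'.1, finProdFinEquiv z'.2) :=
    finProdFinEquiv.injective (Fin.val_injective hz)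
  rw [Prod.mk.injEq] at h1
  exact Prod.ext h1.1 (finProdFinEquiv.injective h1.2)

/-- Enough independent trials contain, with probability at least `1 / 2`, one that is good for
all clusters. -/
theorem half_le_randomLaw_exists {A : Type*} [Fintype A] {T K S : ℕ} {pk : unitInterval → A}
    (hpk : ∀ a, MeasurableSet (pk ⁻¹' {a})) {p : A → ℝ} (hp0 : ∀ a, 0 ≤ p a)
    (hp : ∀ a, p a ≤ volume.real (pk ⁻¹' {a})) {Good : Fin K → Finset (Fin S → A)} {δ : ℝ}
    (hδ : 0 < δ) (hGood : ∀ k, δ ≤ ∑ f ∈ Good k, ∏ i, p (f i)) (hT : (1 / δ) ^ K ≤ T) :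
    (1 / 2 : ENNReal) ≤ randomLaw {ω | ∃ t < T, ∀ k : Fin K,
      (fun i : Fin S => pk (ω (t * (K * S) + (k * S + i)))) ∈ Good k} := by
  classical
  set q : A → ℝ := fun a => volume.real (pk ⁻¹' {a}) with hq
  have hq0 : ∀ a, 0 ≤ q a := fun a => measureReal_nonneg
  have hq1 : ∑ a, q a = 1 := sum_measureReal_preimage hpk
  set Q : (Fin K → Fin S → A) → ℝ := fun g => ∏ k, ∏ i, q (g k i) with hQ
  have hQ0 : ∀ g, 0 ≤ Q g := fun g =>
    Finset.prod_nonneg fun k _ => Finset.prod_nonneg fun i _ => hq0 _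
  have hQ1 : ∑ g, Q g = 1 := by
    have h := Finset.prod_univ_sum (fun _ : Fin K => (Finset.univ : Finset (Fin S → A)))
      (fun _ f => ∏ i, q (f i))
    rw [Fintype.piFinset_univ] at h
    rw [hQ, ← h]
    simp only [sum_prod_eq_pow, hq1, one_pow, Finset.prod_const_one]
  set GT := Fintype.piFinset Good with hGT
  -- The `K` groups of a trial are independent, so the mass of simultaneous success factors.
  -- Replacing `p` by the true probabilities `q` only enlarges it.
  have hgood : δ ^ K ≤ ∑ g ∈ GT, Q g := by
    have e : ∑ g ∈ GT, Q g = ∏ k, ∑ f ∈ Good k, ∏ i, q (f i) :=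
      (Finset.prod_univ_sum Good fun _ f => ∏ i, q (f i)).symm
    rw [e, ← Fin.prod_const]
    refine Finset.prod_le_prod (fun _ _ => hδ.le) fun k _ => (hGood k).trans ?_
    exact Finset.sum_le_sum fun f _ => Finset.prod_le_prod (fun i _ => hp0 _) fun i _ => hp _
  have hbad : ∑ g ∈ GTᶜ, Q g ≤ 1 - δ ^ K := by
    have := Finset.sum_add_sum_compl GT Q
    linarith
  -- All trials fail with probability at most `(1 - δ^K)^T ≤ exp (-T δ^K) ≤ 1/e`.
  have hbad' : (∑ g ∈ GTᶜ, Q g) ^ T ≤ 1 / 2 := by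
    have hδK : 0 < δ ^ K := pow_pos hδ K
    calc (∑ g ∈ GTᶜ, Q g) ^ T ≤ Real.exp (-δ ^ K) ^ T :=
          pow_le_pow_left₀ (Finset.sum_nonneg fun g _ => hQ0 g)
            (hbad.trans (Real.one_sub_le_exp_neg _)) T
      _ = Real.exp (-(T * δ ^ K)) := by rw [← Real.exp_nat_mul]; ring_nf
      _ ≤ Real.exp (-1) := by
          refine Real.exp_le_exp.2 (neg_le_neg ?_)
          rwa [one_div, inv_pow, inv_le_iff_one_le_mul₀ hδK] at hT
      _ ≤ 1 / 2 := by
          rw [Real.exp_neg, one_div]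
          refine inv_anti₀ (by norm_num) ?_
          have := Real.add_one_le_exp (1 : ℝ)
          linarith
  set G := {ω : ℕ → unitInterval | ∃ t < T, ∀ k : Fin K,
      (fun i : Fin S => pk (ω (t * (K * S) + (k * S + i)))) ∈ Good k} with hG
  set Cyl : (Fin T → Fin K → Fin S → A) → Set (ℕ → unitInterval) := fun h =>
    {ω | ∀ z : Fin T × Fin K × Fin S,
      pk (ω (z.1 * (K * S) + (z.2.1 * S + z.2.2))) = h z.1 z.2.1 z.2.2} with hCyl
  -- Failure of every trial lies in a finite union of cylinders. Bounding this union and using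
  -- subadditivity makes measurability of `G` unnecessary.
  have hcover : Set.univ ⊆ G ∪ ⋃ h ∈ Fintype.piFinset (fun _ : Fin T => GTᶜ), Cyl h := by
    intro ω _
    by_cases hω : ω ∈ G
    · exact Or.inl hω
    · refine Or.inr (Set.mem_iUnion₂.2
        ⟨fun t k i => pk (ω (t * (K * S) + (k * S + i))), ?_, fun z => rfl⟩)
      rw [Fintype.mem_piFinset]
      intro t
      rw [Finset.mem_compl, hGT, Fintype.mem_piFinset]
      exact fun h => hω ⟨t, t.2, h⟩
  have hmeas : randomLaw (⋃ h ∈ Fintype.piFinset (fun _ : Fin T => GTᶜ), Cyl h) ≤ 1 / 2 := by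
    refine (measure_biUnion_finset_le _ _).trans ?_
    have hc : ∀ h, randomLaw (Cyl h) = ENNReal.ofReal (∏ t, Q (h t)) := by
      intro h
      rw [hCyl]
      refine (randomLaw_cylinder (sampleIndex_injective T K S) hpk
        (fun z => h z.1 z.2.1 z.2.2)).trans ?_
      rw [Fintype.prod_prod_type]
      simp only [Fintype.prod_prod_type]
      rfl
    simp only [hc]
    rw [← ENNReal.ofReal_sum_of_nonneg fun h _ => Finset.prod_nonneg fun t _ => hQ0 _,
      ← Finset.prod_univ_sum (fun _ : Fin T => GTᶜ) (fun _ g => Q g), Fin.prod_const]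
    refine (ENNReal.ofReal_le_ofReal hbad').trans_eq ?_
    rw [ENNReal.ofReal_div_of_pos two_pos]
    simp
  have h1 : (1 : ENNReal) ≤ randomLaw G + 1 / 2 :=
    calc (1 : ENNReal) = randomLaw Set.univ := measure_univ.symm
      _ ≤ _ := (measure_mono hcover).trans ((measure_union_le _ _).trans (by gcongr))
  exact (ENNReal.add_le_add_iff_right (by simp)).1 ((ENNReal.add_halves 1).trans_le h1)

/-- Only the first `N - 1` partial sums are compared, so the index stays in range even for `u = 1`.
-/
theorem pick_lt {N : ℕ} (hN : 0 < N) (w : ℕ → ℝ) (u : ℝ) : pick N w u < N := by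
  have := Finset.card_filter_le (Finset.range (N - 1)) fun n =>
    ∑ i ∈ Finset.range (n + 1), w i ≤ u * ∑ i ∈ Finset.range N, w i
  rw [Finset.card_range] at this
  rw [pick]
  omega

theorem pick_mono {N : ℕ} {w : ℕ → ℝ} (hw : ∀ n, 0 ≤ w n) : Monotone (pick N w) := by
  intro u v huv
  refine Finset.card_le_card (Finset.monotone_filter_right _ fun n _ hn => hn.trans ?_)
  exact mul_le_mul_of_nonneg_right huv (Finset.sum_nonneg fun i _ => hw i)

theorem measurableSet_pick {N : ℕ} {w : ℕ → ℝ} (hw : ∀ n, 0 ≤ w n) (n : ℕ) :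
    MeasurableSet {u : unitInterval | pick N w u = n} := by
  have hm : Measurable fun u : unitInterval => pick N w u :=
    (pick_mono hw).measurable.comp measurable_subtype_coe
  exact hm (measurableSet_singleton n)

/-- Index `n` is chosen at least on the half-open interval between two consecutive normalised
partial sums, whose length is the claimed bound. -/
theorem div_le_volume_pick {N : ℕ} {w : ℕ → ℝ} (hw : ∀ n, 0 ≤ w n)
    (hpos : 0 < ∑ i ∈ Finset.range N, w i) {n : ℕ} (hn : n < N) :
    w n / ∑ i ∈ Finset.range N, w i ≤ volume.real {u : unitInterval | pick N w u = n} := by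
  set W := ∑ i ∈ Finset.range N, w i with hW
  set acc : ℕ → ℝ := fun n => ∑ i ∈ Finset.range n, w i with hacc
  have hmono : Monotone acc := monotone_nat_of_le_succ fun i => by
    simp only [hacc, Finset.sum_range_succ]
    linarith [hw i]
  have hI : ∀ i ≤ N, acc i / W ∈ Set.Icc (0 : ℝ) 1 := fun i hi =>
    ⟨div_nonneg (Finset.sum_nonneg fun i _ => hw i) hpos.le,
      (div_le_one hpos).2 (hmono hi)⟩
  have hsub : Set.Ico (⟨acc n / W, hI n hn.le⟩ : unitInterval) ⟨acc (n + 1) / W, hI _ hn⟩ ⊆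
      {u : unitInterval | pick N w u = n} := by
    rintro u ⟨h1, h2⟩
    have h1' : acc n ≤ u * W := (div_le_iff₀ hpos).1 h1
    have h2' : u * W < acc (n + 1) := (lt_div_iff₀ hpos).1 h2
    have : (Finset.range (N - 1)).filter (fun i => acc (i + 1) ≤ u * W) = Finset.range n := by
      ext i
      rw [Finset.mem_filter, Finset.mem_range, Finset.mem_range]
      constructor
      · rintro ⟨-, hi⟩
        by_contra hni
        have := hmono (show n + 1 ≤ i + 1 by omega)
        linarith
      · intro hi
        exact ⟨by omega, (hmono (show i + 1 ≤ n by omega)).trans h1'⟩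
    change ((Finset.range (N - 1)).filter (fun i => acc (i + 1) ≤ u * W)).card = n
    rw [this, Finset.card_range]
  refine le_trans (le_of_eq ?_) (measureReal_mono hsub)
  rw [measureReal_def, unitInterval.volume_Ico, ENNReal.toReal_ofReal]
  · simp only [hacc, Finset.sum_range_succ]
    ring
  · simp only [sub_nonneg]
    exact div_le_div_of_nonneg_right (hmono (Nat.le_succ n)) hpos.le

/-! ### Time bounds -/

theorem sampleSize_le {ε : ℝ} (hε : 0 < ε) (hε1 : ε ≤ 1) : (⌈2 / ε⌉₊ : ℝ) ≤ 3 / ε := by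
  have h1 : (⌈2 / ε⌉₊ : ℝ) ≤ 2 / ε + 1 := (Nat.ceil_lt_add_one (by positivity)).le
  have h2 : 1 ≤ 1 / ε := (one_le_div hε).2 hε1
  calc _ ≤ 2 / ε + 1 / ε := by linarith
    _ = 3 / ε := by ring

theorem two_le_sampleSize_mul {ε : ℝ} (hε : 0 < ε) : 2 ≤ (⌈2 / ε⌉₊ : ℝ) * ε :=
  (div_le_iff₀ hε).1 (Nat.le_ceil _)

/-- Every quantity in the exponents of the running times is a bounded multiple of `K ^ 2 / ε`. -/
theorem exponent_le {K S ε : ℝ} (hK : 1 ≤ K) (hε : 0 < ε) (hε1 : ε ≤ 1) (hS : S ≤ 3 / ε) :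
    1 ≤ K ^ 2 / ε ∧ K ≤ K ^ 2 / ε ∧ S ≤ 3 * (K ^ 2 / ε) ∧ K * S ≤ 3 * (K ^ 2 / ε) := by
  have e1 : 1 ≤ 1 / ε := (one_le_div hε).2 hε1
  have hS' : S ≤ 3 * (1 / ε) := hS.trans_eq (by ring)
  rw [div_eq_mul_one_div (K ^ 2)]
  set e := 1 / ε
  have hKK : K ≤ K ^ 2 := by nlinarith
  have hKe : K * e ≤ K ^ 2 * e := mul_le_mul_of_nonneg_right hKK (by linarith)
  have hKe1 : K ≤ K * e := by nlinarith
  have hee : e ≤ K * e := by nlinarith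
  have hKS : K * S ≤ 3 * (K * e) := by nlinarith
  exact ⟨by linarith, by linarith, by linarith, by linarith⟩

/-- All factors but `D` become powers of `M = max N 2`, using `a + 1 ≤ M ^ a`. The exponent `K * S +
K + S + 15` is at most `3 + 1 + 3 + 15 = 22` times `K ^ 2 / ε`. -/
theorem exhaustive_time_le {N D K S : ℕ} (hD : 1 ≤ D) {ε : ℝ}
    (hK : 1 ≤ K) (hε : 0 < ε) (hε1 : ε ≤ 1) (hS : (S : ℝ) ≤ 3 / ε) :
    (((N ^ (K * S) + 1) * ((K + 1) * ((D + 1) * ((S + 1) * ((N + 1) * 2000)))) : ℕ) : ℝ) ≤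
      D * ((max N 2 : ℕ) : ℝ) ^ (22 * ((K : ℝ) ^ 2 / ε)) := by
  set M := max N 2 with hM
  have hM2 : 2 ≤ M := le_max_right _ _
  have hNM : N ≤ M := le_max_left _ _
  have htwo : ∀ a : ℕ, a + 1 ≤ M ^ a := fun a =>
    (Nat.lt_two_pow_self (n := a)).trans_le (Nat.pow_le_pow_left hM2 a)
  have h1 : N ^ (K * S) + 1 ≤ M ^ (K * S) * M := by
    have h := Nat.pow_le_pow_left hNM (K * S)
    have h' : 1 ≤ M ^ (K * S) := Nat.one_le_pow _ _ (by omega)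
    nlinarith
  have h2 : D + 1 ≤ D * M := by nlinarith
  have h3 : N + 1 ≤ M * M := by nlinarith
  have h4 : 2000 ≤ M ^ 11 := le_trans (by norm_num) (Nat.pow_le_pow_left hM2 11)
  have hnat : (N ^ (K * S) + 1) * ((K + 1) * ((D + 1) * ((S + 1) * ((N + 1) * 2000)))) ≤
      D * M ^ (K * S + K + S + 15) :=
    calc _ ≤ (M ^ (K * S) * M) * (M ^ K * ((D * M) * (M ^ S * ((M * M) * M ^ 11)))) := by
          gcongr
          exacts [htwo K, htwo S]
      _ = _ := by ring
  refine (Nat.cast_le.2 hnat).trans ?_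
  push_cast
  refine mul_le_mul_of_nonneg_left ?_ (Nat.cast_nonneg D)
  rw [← Real.rpow_natCast]
  refine Real.rpow_le_rpow_of_exponent_le (by exact_mod_cast (show 1 ≤ M by omega)) ?_
  have hK' : (1 : ℝ) ≤ K := by exact_mod_cast hK
  obtain ⟨h1, h2, h3, h4⟩ := exponent_le hK' hε hε1 hS
  push_cast
  linarith

theorem random_time_le {N D K S : ℕ} (hN : 1 ≤ N) (hD : 1 ≤ D) {ε α : ℝ}
    (hK : 1 ≤ K) (hε : 0 < ε) (hε1 : ε ≤ 1) (hα : 0 < α) (hα1 : α ≤ 1) (hS : (S : ℝ) ≤ 3 / ε) :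
    (((⌈(2 / α ^ S) ^ K⌉₊ + 1) * ((K + 1) * ((D + 1) * ((S + 1) * ((N + 1) * 2000)))) : ℕ) : ℝ) ≤
      N * D * (2 : ℝ) ^ (23 * ((K : ℝ) ^ 2 / ε * max 1 (Real.logb 2 (1 / (α * ε))))) := by
  set Λ := max 1 (Real.logb 2 (1 / (α * ε))) with hΛ
  have hΛ1 : 1 ≤ Λ := le_max_left _ _
  have hK' : (1 : ℝ) ≤ K := by exact_mod_cast hK
  set β := (2 / α ^ S) ^ K with hβ
  have hαS : α ^ S ≤ 1 := pow_le_one₀ hα.le hα1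
  have hαS0 : 0 < α ^ S := pow_pos hα S
  have hβ1 : 1 ≤ β := one_le_pow₀ ((one_le_div hαS0).2 (by linarith))
  have hαΛ : 1 / α ≤ (2 : ℝ) ^ Λ := by
    have h0 : 0 < 1 / (α * ε) := by positivity
    calc 1 / α ≤ 1 / (α * ε) :=
          one_div_le_one_div_of_le (by positivity) (by nlinarith)
      _ = (2 : ℝ) ^ Real.logb 2 (1 / (α * ε)) :=
          (Real.rpow_logb (by norm_num) (by norm_num) h0).symm
      _ ≤ (2 : ℝ) ^ Λ := Real.rpow_le_rpow_of_exponent_le (by norm_num) (le_max_right _ _)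
  have hβΛ : β ≤ (2 : ℝ) ^ ((1 + Λ * S) * K) := by
    have h2 : 2 / α ^ S ≤ (2 : ℝ) ^ (1 + Λ * S) := by
      rw [Real.rpow_add two_pos, Real.rpow_one, Real.rpow_mul two_pos.le, Real.rpow_natCast,
        div_eq_mul_one_div, ← one_div_pow]
      gcongr
    rw [Real.rpow_mul two_pos.le, Real.rpow_natCast, hβ]
    exact pow_le_pow_left₀ (by positivity) h2 K
  -- This factor `2 ^ 2` and the `2 ^ 13` in `hnat` make up the summand `15` of the exponent. The
  -- total coefficient is `1 + 3 + 1 + 3 + 15 = 23`, for the terms `K`, `Λ S K`, `K`, `S` and `15`.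
  have hceil : ((⌈β⌉₊ + 1 : ℕ) : ℝ) ≤ 2 ^ 2 * β := by
    have := (Nat.ceil_lt_add_one (zero_le_one.trans hβ1)).le
    push_cast
    linarith
  have htwo : ∀ a : ℕ, a + 1 ≤ 2 ^ a := fun a => Nat.lt_two_pow_self
  have hnat : (K + 1) * ((D + 1) * ((S + 1) * ((N + 1) * 2000))) ≤
      N * D * 2 ^ (K + S + 13) :=
    calc _ ≤ 2 ^ K * ((D * 2) * (2 ^ S * ((N * 2) * 2 ^ 11))) := by
          gcongr
          exacts [htwo K, by omega, htwo S, by omega, by norm_num]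
      _ = _ := by ring
  have hnat' : (((K + 1) * ((D + 1) * ((S + 1) * ((N + 1) * 2000))) : ℕ) : ℝ) ≤
      N * D * 2 ^ (K + S + 13) := by
    refine (Nat.cast_le.2 hnat).trans ?_
    push_cast
    exact le_rfl
  rw [Nat.cast_mul]
  calc _ ≤ (2 ^ 2 * (2 : ℝ) ^ ((1 + Λ * S) * K)) * (N * D * 2 ^ (K + S + 13)) := by
        refine mul_le_mul (hceil.trans ?_) hnat' (Nat.cast_nonneg _) (by positivity)
        gcongr
    _ = N * D * (2 : ℝ) ^ ((1 + Λ * S) * K + ((K + S + 15 : ℕ) : ℝ)) := by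
        rw [Real.rpow_add two_pos, Real.rpow_natCast]
        ring
    _ ≤ _ := by
        refine mul_le_mul_of_nonneg_left ?_ (by positivity)
        refine Real.rpow_le_rpow_of_exponent_le (by norm_num) ?_
        obtain ⟨h1, h2, h3, h4⟩ := exponent_le hK' hε hε1 hS
        have h5 := le_mul_of_one_le_right (zero_le_one.trans h1) hΛ1
        have h6 := mul_le_mul_of_nonneg_right h4 (zero_le_one.trans hΛ1)
        push_cast
        linarith

/-! ### Correctness for the given input -/

variable {N D K L m : ℕ} {x : Fin N → EuclideanSpace ℝ (Fin D)} {w : Fin N → ℝ} {ε α : ℝ}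

/-- The state `s` holds the input. -/
structure State.Holds (s : State) (K m : ℕ) (x : Fin N → EuclideanSpace ℝ (Fin D))
    (w : Fin N → ℝ) (ε : ℝ) : Prop where
  points : s.nat 0 0 0 = N
  dim : s.nat 1 0 0 = D
  means : s.nat 2 0 0 = K
  fuzzifier : s.nat 3 0 0 = m
  point : ∀ (n : Fin N) (d : Fin D), s.real 0 n d = x n d
  weight : ∀ n : Fin N, s.real 1 n 0 = w n
  eps : s.real 2 0 0 = ε

theorem inputState_isInitial : (inputState K m x w ε).IsInitial where
  nat a ha i j := by
    simp only [inputState]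
    split_ifs <;> first | rfl | omega
  real a ha i j := by
    simp only [inputState]
    split_ifs <;> first | rfl | omega
  drawn := rfl

theorem inputState_holds : (inputState K m x w ε).Holds K m x w ε where
  points := by simp [inputState]
  dim := by simp [inputState]
  means := by simp [inputState]
  fuzzifier := by simp [inputState]
  point n d := by simp [inputState]
  weight n := by simp [inputState]
  eps := by simp [inputState]

theorem inputStateWith_isInitial : (inputStateWith K m x w ε α).IsInitial where
  nat := (inputState_isInitial (K := K) (m := m) (x := x) (w := w) (ε := ε)).nat
  real a ha i j := by
    rw [inputStateWith, State.writeReal_real_of_ne (by omega)]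
    exact (inputState_isInitial (K := K) (m := m) (x := x) (w := w) (ε := ε)).real a ha i j
  drawn := rfl

theorem inputStateWith_holds : (inputStateWith K m x w ε α).Holds K m x w ε where
  points := (inputState_holds (K := K) (m := m) (x := x) (w := w) (ε := ε)).points
  dim := (inputState_holds (K := K) (m := m) (x := x) (w := w) (ε := ε)).dim
  means := (inputState_holds (K := K) (m := m) (x := x) (w := w) (ε := ε)).means
  fuzzifier := (inputState_holds (K := K) (m := m) (x := x) (w := w) (ε := ε)).fuzzifier
  point n d := by
    rw [inputStateWith, State.writeReal_real_of_ne (by decide)]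
    exact (inputState_holds (K := K) (m := m) (x := x) (w := w) (ε := ε)).point n d
  weight n := by
    rw [inputStateWith, State.writeReal_real_of_ne (by decide)]
    exact (inputState_holds (K := K) (m := m) (x := x) (w := w) (ε := ε)).weight n
  eps := by
    rw [inputStateWith, State.writeReal_real_of_ne (by decide)]
    exact (inputState_holds (K := K) (m := m) (x := x) (w := w) (ε := ε)).eps

theorem State.Holds.costOf_eq {s : State} (hs : s.Holds K m x w ε) (hK : 1 ≤ K) (hm : 2 ≤ m)
    {C : ℕ → ℕ → ℝ} {μ : Fin K → EuclideanSpace ℝ (Fin D)}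
    (hC : ∀ (k : Fin K) (d : Fin D), C k d = μ k d) : s.costOf C = costOfMeans m x w μ := by
  rw [State.costOf, hs.points, hs.dim, hs.means, hs.fuzzifier]
  exact (costOfMeans_eq hK hm hs.point hs.weight hC).symm

/-- Samples that are good for all clusters yield a `(1 + ε)`-approximation. -/
theorem State.Holds.costOf_sampleMeans_le {s : State} (hs : s.Holds K m x w ε) (hK : 1 ≤ K)
    (hm : 2 ≤ m) (hw : ∀ n, 0 ≤ w n) (hLK : L ≤ K) {r : Fin N → Fin L → ℝ} (hr : IsMembership r)
    {S : ℕ} {f : ℕ → ℕ} {g : Fin K → Fin S → Fin N} (hf : ∀ (k : Fin K) (i : Fin S), f (k * S + i) = g k i)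
    (hg : ∀ l, IsGoodSample (fun n => r n l ^ m * w n) x (inducedMeans m x w r l) ε
      (g (Fin.castLE hLK l))) :
    s.costOf (sampleMeans S (s.real 0) f) ≤ (1 + ε) * costOfMemberships m x w r := by
  rw [hs.costOf_eq hK hm (μ := fun k => (S : ℝ)⁻¹ • ∑ i, x (g k i))]
  · exact costOfMeans_le_of_isGoodSample hm hLK hw hr (fun _ => rfl) hg
  · intro k d
    rw [sampleMeans, Finset.sum_range]
    simp only [hf, hs.point]
    simp [div_eq_inv_mul]

theorem exists_flatten {K S N : ℕ} (hN : 0 < N) (g : Fin K → Fin S → Fin N) :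
    ∃ f : ℕ → ℕ, (∀ j, f j < N) ∧ ∀ (k : Fin K) (i : Fin S), f (k * S + i) = g k i := by
  refine ⟨fun j => if h : j < K * S then
    g (finProdFinEquiv.symm ⟨j, h⟩).1 (finProdFinEquiv.symm ⟨j, h⟩).2 else 0, fun j => ?_,
    fun k i => ?_⟩
  · dsimp only
    split_ifs
    exacts [Fin.is_lt _, hN]
  · have hj : (k * S + i : ℕ) = (finProdFinEquiv (k, i) : Fin (K * S)) := by
      rw [finProdFinEquiv_apply_val]
      ring
    have hlt : (k * S + i : ℕ) < K * S := by
      rw [hj]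
      exact Fin.is_lt _
    have he : (⟨k * S + i, hlt⟩ : Fin (K * S)) = finProdFinEquiv (k, i) := Fin.ext hj
    dsimp only
    rw [dif_pos hlt, he, Equiv.symm_apply_apply]

theorem exhaustiveProg_deterministic : exhaustiveProg.Deterministic := by
  simp [exhaustiveProg, sizeProg, initProg, searchProg, incrementProg, digitProg, trialProg,
    meansProg, meanProg, coordProg, costProg, pointProg, sqDistProg, updateProg, copyProg,
    Program.forLoop, Program.Deterministic]

theorem exhaustiveProg_approximates (hN : 1 ≤ N) (hK : 1 ≤ K) (hm : 2 ≤ m) (hw : ∀ n, 0 ≤ w n)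
    (hε : 0 < ε) {s' : State} (hs' : ∀ f : ℕ → ℕ, (∀ j, f j < N) →
      (inputState K m x w ε).costOf (s'.real 4) ≤ (inputState K m x w ε).costOf
        (sampleMeans ⌈2 / ε⌉₊ ((inputState K m x w ε).real 0) f))
    (hLK : L ≤ K) {r : Fin N → Fin L → ℝ} (hr : IsMembership r) :
    costOfMeans m x w (outputMeans D K s') ≤ (1 + ε) * costOfMemberships m x w r := by
  have : Nonempty (Fin N) := ⟨⟨0, hN⟩⟩
  have hex : ∀ l, ∃ f : Fin ⌈2 / ε⌉₊ → Fin N,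
      IsGoodSample (fun n => r n l ^ m * w n) x (inducedMeans m x w r l) ε f := fun l =>
    exists_isGoodSample (fun n => mul_nonneg (pow_nonneg (hr.nonneg n l) m) (hw n))
      (sum_smul_sub_inducedMeans hw hr.nonneg l) hε (two_le_sampleSize_mul hε)
  choose g hg using hex
  -- The samples of the `K - L` superfluous means are arbitrary; the point with index zero serves.
  obtain ⟨f, hfN, hf⟩ := exists_flatten hN fun (k : Fin K) (i : Fin ⌈2 / ε⌉₊) =>
    if h : (k : ℕ) < L then g ⟨k, h⟩ i else ⟨0, hN⟩
  rw [← inputState_holds.costOf_eq (ε := ε) hK hm (C := s'.real 4) fun k d => rfl]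
  refine (hs' f hfN).trans (inputState_holds.costOf_sampleMeans_le hK hm hw hLK hr hf fun l => ?_)
  simpa using hg l

/-- Drawing by the weights `w` instead of the unknown masses `r^m w` costs, for each cluster, a
factor of at most `(R_l / W)^S` in the probability of a good sample, and this factor is at least
`α^S`. -/
theorem half_le_randomLaw_approximates (hN : 1 ≤ N) (hK : 1 ≤ K) (hm : 2 ≤ m)
    (hw : ∀ n, 0 ≤ w n) (hε : 0 < ε) (hα : 0 < α) (hLK : L ≤ K) {r : Fin N → Fin L → ℝ}
    (hr : IsMembership r) (hweight : ∀ l, α * ∑ n, w n ≤ clusterWeight m w r l)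
    (hpos : 0 < ∑ n, w n) :
    (1 / 2 : ENNReal) ≤ randomLaw {ω | ∃ t < ⌈(2 / α ^ ⌈2 / ε⌉₊) ^ K⌉₊,
      (inputStateWith K m x w ε α).costOf
        (sampleMeans ⌈2 / ε⌉₊ ((inputStateWith K m x w ε α).real 0) fun j =>
          pick N (fun n => (inputStateWith K m x w ε α).real 1 n 0)
            (ω (t * (K * ⌈2 / ε⌉₊) + j))) ≤ (1 + ε) * costOfMemberships m x w r} := by
  classical
  set S := ⌈2 / ε⌉₊ with hS
  set s := inputStateWith K m x w ε α with hs
  have hh : s.Holds K m x w ε := inputStateWith_holds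
  set W : ℕ → ℝ := fun n => s.real 1 n 0 with hW
  have hWn : ∀ n : Fin N, W n = w n := hh.weight
  have hW0 : ∀ n, 0 ≤ W n := by
    intro n
    by_cases hn : n < N
    · exact (hWn ⟨n, hn⟩).symm ▸ hw ⟨n, hn⟩
    · rw [hW, hs, inputStateWith]
      dsimp only
      rw [State.writeReal_real_of_ne (by decide)]
      simp [inputState, hn]
  have hWs : ∑ n ∈ Finset.range N, W n = ∑ n, w n := by
    rw [Finset.sum_range]
    exact Finset.sum_congr rfl fun n _ => hWn n
  set pk : unitInterval → Fin N := fun u => ⟨pick N W u, pick_lt hN W u⟩ with hpk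
  have hpre : ∀ n : Fin N, pk ⁻¹' {n} = {u : unitInterval | pick N W u = n} := fun n => by
    ext u
    simp [hpk, Fin.ext_iff]
  set p : Fin N → ℝ := fun n => w n / ∑ n, w n with hp
  have hp0 : ∀ n, 0 ≤ p n := fun n => div_nonneg (hw n) hpos.le
  set Good : Fin K → Finset (Fin S → Fin N) := fun k => if h : (k : ℕ) < L then
    Finset.univ.filter fun f => IsGoodSample (fun n => r n ⟨k, h⟩ ^ m * w n) x
      (inducedMeans m x w r ⟨k, h⟩) ε f else Finset.univ with hGood
  have hps : ∑ n, p n = 1 := by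
    rw [hp, ← Finset.sum_div, div_self hpos.ne']
  have hL : 0 < L := by
    by_contra h
    obtain rfl : L = 0 := by omega
    have := hr.sum_eq_one ⟨0, hN⟩
    simp at this
  have hα1 : α ≤ 1 := by
    have h1 : clusterWeight m w r ⟨0, hL⟩ ≤ ∑ n, w n := Finset.sum_le_sum fun n _ =>
      mul_le_of_le_one_left (hw n) (pow_le_one₀ (hr.nonneg n _) (hr.le_one n _))
    have h2 := (hweight ⟨0, hL⟩).trans h1
    nlinarith
  have hδ : ∀ k, α ^ S / 2 ≤ ∑ f ∈ Good k, ∏ i, p (f i) := by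
    intro k
    rw [hGood]
    dsimp only
    split_ifs with h
    · set l : Fin L := ⟨k, h⟩
      have hhalf := half_le_sum_isGoodSample (x := x) (μ := inducedMeans m x w r l) (s := S)
        (fun n => mul_nonneg (pow_nonneg (hr.nonneg n l) m) (hw n))
        (sum_smul_sub_inducedMeans hw hr.nonneg l) hε (two_le_sampleSize_mul hε)
      have hlow : (α * ∑ n, w n) ^ S / 2 ≤ (∑ n, r n l ^ m * w n) ^ S / 2 := by
        have := pow_le_pow_left₀ (mul_nonneg hα.le hpos.le) (hweight l) S
        rw [clusterWeight] at this
        linarith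
      -- Memberships are at most `1`, so the mass in a cluster never exceeds the weight of the
      -- point.
      have hup : ∀ f : Fin S → Fin N, ∏ i, r (f i) l ^ m * w (f i) ≤
          (∏ i, p (f i)) * (∑ n, w n) ^ S := by
        intro f
        rw [← Fin.prod_const, ← Finset.prod_mul_distrib]
        refine Finset.prod_le_prod
          (fun i _ => mul_nonneg (pow_nonneg (hr.nonneg _ l) m) (hw _)) fun i _ => ?_
        rw [hp]
        dsimp only
        rw [div_mul_cancel₀ _ hpos.ne']
        exact mul_le_of_le_one_left (hw _) (pow_le_one₀ (hr.nonneg _ _) (hr.le_one _ _))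
      have hfin := hlow.trans (hhalf.trans (Finset.sum_le_sum fun f _ => hup f))
      rw [← Finset.sum_mul, mul_pow, mul_div_right_comm] at hfin
      exact le_of_mul_le_mul_right hfin (pow_pos hpos S)
    -- For a superfluous mean every sample counts as good, with probability `1 ≥ α^S / 2`.
    · rw [sum_prod_eq_pow, hps, one_pow]
      have := pow_le_one₀ (n := S) hα.le hα1
      linarith
  have hT : (1 / (α ^ S / 2)) ^ K ≤ (⌈(2 / α ^ S) ^ K⌉₊ : ℝ) := by
    rw [one_div_div]
    exact Nat.le_ceil _
  refine (half_le_randomLaw_exists (pk := pk) (fun n => ?_) hp0 (fun n => ?_)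
    (half_pos (pow_pos hα S)) hδ hT).trans (MeasureTheory.measure_mono ?_)
  · rw [hpre]
    exact measurableSet_pick hW0 n
  · rw [hpre, hp]
    dsimp only
    rw [← hWs, ← hWn]
    exact div_le_volume_pick hW0 (hWs ▸ hpos) n.2
  · rintro ω ⟨t, ht, hω⟩
    refine ⟨t, ht, hh.costOf_sampleMeans_le hK hm hw hLK hr
      (g := fun k i => pk (ω (t * (K * S) + (k * S + i)))) (fun k i => rfl) fun l => ?_⟩
    have := hω (Fin.castLE hLK l)
    rw [hGood] at this
    simpa using this

theorem costOfMeans_le_of_sum_eq_zero (hw : ∀ n, 0 ≤ w n) (h : ∑ n, w n = 0)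
    (μ : Fin K → EuclideanSpace ℝ (Fin D)) (r : Fin N → Fin L → ℝ) :
    costOfMeans m x w μ ≤ (1 + ε) * costOfMemberships m x w r := by
  rw [Finset.sum_eq_zero_iff_of_nonneg fun n _ => hw n] at h
  have h0 : ∀ n, w n = 0 := fun n => h n (Finset.mem_univ n)
  simp [costOfMeans, costOfMemberships, cost, h0]

end FuzzyKMeans

end

/-! ### The two approximation algorithms -/

theorem proposition1 :
    (∃ (P : FuzzyKMeans.Program) (c : ℝ),
      ∀ (N D K m : ℕ) (x : Fin N → EuclideanSpace ℝ (Fin D)) (w : Fin N → ℚ) (ε α : ℝ),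
        1 ≤ N → 1 ≤ D → 1 ≤ K → 2 ≤ m → (∀ n, 0 ≤ w n) →
        0 < ε → ε ≤ 1 → 0 < α → α ≤ 1 →
        (∀ ω : ℕ → unitInterval,
          FuzzyKMeans.HaltsWithin ω P
            (FuzzyKMeans.inputStateWith K m x (fun n => (w n : ℝ)) ε α)
            (N * D * (2 : ℝ) ^ (c * ((K : ℝ) ^ 2 / ε * max 1 (Real.logb 2 (1 / (α * ε))))))) ∧
        ∀ (L : ℕ) (r : Fin N → Fin L → ℝ),
          FuzzyKMeans.InducesOptimalBalanced m x (fun n => (w n : ℝ))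
            (max (α * ∑ n, (w n : ℝ)) (16 * K * (⨆ n, (w n : ℝ)) / ε)) K r →
          (1 / 2 : ENNReal) ≤ FuzzyKMeans.randomLaw
            {ω | ∃ (s : FuzzyKMeans.State) (t : ℕ),
              FuzzyKMeans.Exec ω P
                (FuzzyKMeans.inputStateWith K m x (fun n => (w n : ℝ)) ε α) s t ∧
              FuzzyKMeans.costOfMeans m x (fun n => (w n : ℝ))
                  (FuzzyKMeans.outputMeans D K s) ≤
                (1 + ε) * FuzzyKMeans.costOfMemberships m x (fun n => (w n : ℝ)) r}) ∧
    (∃ (P : FuzzyKMeans.Program) (c : ℝ), P.Deterministic ∧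
      ∀ (N D K m : ℕ) (x : Fin N → EuclideanSpace ℝ (Fin D)) (w : Fin N → ℚ) (ε : ℝ),
        1 ≤ N → 1 ≤ D → 1 ≤ K → 2 ≤ m → (∀ n, 0 ≤ w n) → 0 < ε → ε ≤ 1 →
        ∀ ω : ℕ → unitInterval, ∃ (s : FuzzyKMeans.State) (t : ℕ),
          FuzzyKMeans.Exec ω P (FuzzyKMeans.inputState K m x (fun n => (w n : ℝ)) ε) s t ∧
          (t : ℝ) ≤ D * ((max N 2 : ℕ) : ℝ) ^ (c * ((K : ℝ) ^ 2 / ε)) ∧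
          ∀ (L : ℕ) (r : Fin N → Fin L → ℝ),
            FuzzyKMeans.InducesOptimalBalanced m x (fun n => (w n : ℝ))
              (16 * K * (⨆ n, (w n : ℝ)) / ε) K r →
            FuzzyKMeans.costOfMeans m x (fun n => (w n : ℝ))
                (FuzzyKMeans.outputMeans D K s) ≤
              (1 + ε) * FuzzyKMeans.costOfMemberships m x (fun n => (w n : ℝ)) r) := by
  refine ⟨⟨FuzzyKMeans.randomProg, 23, ?_⟩,
    FuzzyKMeans.exhaustiveProg, 22, FuzzyKMeans.exhaustiveProg_deterministic, ?_⟩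
  · intro N D K m x w ε α hN hD hK hm hw hε hε1 hα hα1
    have hw' : ∀ n, 0 ≤ (w n : ℝ) := fun n => by exact_mod_cast hw n
    have hh := FuzzyKMeans.inputStateWith_holds (K := K) (m := m) (x := x)
      (w := fun n => (w n : ℝ)) (ε := ε) (α := α)
    have h3 : (FuzzyKMeans.inputStateWith K m x (fun n => (w n : ℝ)) ε α).real 3 0 0 = α := by
      simp [FuzzyKMeans.inputStateWith, FuzzyKMeans.State.writeReal]
    have hrun := fun ω => FuzzyKMeans.randomProg_spec (ω := ω) _
      (FuzzyKMeans.inputStateWith_isInitial (K := K) (m := m) (x := x)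
        (w := fun n => (w n : ℝ)) (ε := ε) (α := α)) (by rwa [hh.eps])
    simp only [hh.points, hh.dim, hh.means, hh.eps, h3, FuzzyKMeans.State.size] at hrun
    refine ⟨fun ω => ?_, fun L r hr => ?_⟩
    · obtain ⟨s', t, he, ht, -⟩ := hrun ω
      exact ⟨s', t, he, (Nat.cast_le.2 ht).trans (FuzzyKMeans.random_time_le hN hD hK hε hε1 hα hα1
        (FuzzyKMeans.sampleSize_le hε hε1))⟩
    · have hbal := hr.1
      -- If all weights vanish, the sampling probabilities make no sense, but every solution costs
      -- zero, so any output will do.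
      rcases (Finset.sum_nonneg fun n _ => hw' n : 0 ≤ ∑ n, (w n : ℝ)).eq_or_lt with h0 | hpos
      · refine le_of_le_of_eq ?_ (congrArg _ (Set.eq_univ_of_forall fun ω => ?_).symm)
        · rw [MeasureTheory.measure_univ]
          exact ENNReal.half_le_self
        · obtain ⟨s', t, he, -, -⟩ := hrun ω
          exact ⟨s', t, he, FuzzyKMeans.costOfMeans_le_of_sum_eq_zero hw' h0.symm _ r⟩
      · refine (FuzzyKMeans.half_le_randomLaw_approximates (x := x) hN hK hm hw' hε hα hbal.card_le
          hbal.isMembership (fun l => (le_max_left _ _).trans (hbal.le_weight l)) hpos).trans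
            (MeasureTheory.measure_mono ?_)
        -- The output is at least as good as each trial, hence as good as the successful trial `i`.
        rintro ω ⟨i, hi, hcost⟩
        obtain ⟨s', t, he, -, hs'⟩ := hrun ω
        refine ⟨s', t, he, ?_⟩
        rw [← hh.costOf_eq hK hm (C := s'.real 4) fun k d => rfl]
        exact (hs' i hi).trans hcost
  · intro N D K m x w ε hN hD hK hm hw hε hε1 ω
    have hw' : ∀ n, 0 ≤ (w n : ℝ) := fun n => by exact_mod_cast hw n
    have hh := FuzzyKMeans.inputState_holds (K := K) (m := m) (x := x)
      (w := fun n => (w n : ℝ)) (ε := ε)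
    have hrun := FuzzyKMeans.exhaustiveProg_spec (ω := ω) _
      (FuzzyKMeans.inputState_isInitial (K := K) (m := m) (x := x)
        (w := fun n => (w n : ℝ)) (ε := ε)) (by rw [hh.points]; exact hN) (by rwa [hh.eps])
    simp only [hh.points, hh.dim, hh.means, hh.eps, FuzzyKMeans.State.size] at hrun
    obtain ⟨s', t, he, ht, hs'⟩ := hrun
    refine ⟨s', t, he, (Nat.cast_le.2 ht).trans (FuzzyKMeans.exhaustive_time_le hD hK hε hε1
      (FuzzyKMeans.sampleSize_le hε hε1)), fun L r hr => ?_⟩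
    exact FuzzyKMeans.exhaustiveProg_approximates hN hK hm hw' hε hs' hr.1.card_le
      hr.1.isMembership
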